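/- Let $n\ge 2$. The contracted zigzag graph $\widehat{\mathrm{Zig}}_n$ has vertices $1,\dots,n$, slack edges $x_i:i\to i+1$ ($1\le i\le n-1$), and nonslack edges $y_0:1\to 2$, $y_i:i\to i+2$ ($1\le i\le n-2$), $y_{n-1}:n-1\to n$. Routes are the directed paths from $1$ to $n$. The length-reverse-length (LRL) framing orders, at each inner vertex $2\le i\le n-1$, the incoming edges by $y_{i-2}\prec x_{i-1}$ and the outgoing edges by $x_i\prec y_i$. It orders the paths from $1$ to $i$ (by comparing the incoming edges at the last vertex where two of them come together) and the paths from $i$ to $n$ (by comparing the outgoing edges at the first vertex where two of them diverge). Two routes are coherent if there is no common inner vertex $i$ at which one writes them as $PQ$ and $P'Q'$ with $P\prec P'$ and $Q'\prec Q$, or with $P'\prec P$ and $Q\prec Q'$. For an inclusion-maximal set $C$ of pairwise coherent routes let $\Delta_C$ be the convex hull of the unit flows along the routes of $C$. The simplices $\Delta_C$ form the DKK triangulation $\mathcal T_n^{\mathrm{LRL}}$ of the polytope of nonnegative unit flows from $1$ to $n$. Its dual graph $D(\mathcal T_n^{\mathrm{LRL}})$ has the simplices $\Delta_C$ as vertices,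 two distinct ones being adjacent if they share a face of codimension $1$. Let $\mathcal F_n^{\mathbb Z}$ be the set of nonnegative integer flows on $\widehat{\mathrm{Zig}}_n$ with net flow vector $(0,1,\dots,1,-(n-2))$. To $C$ corresponds the flow $\phi_C\in\mathcal F_n^{\mathbb Z}$ which is $0$ on the edges leaving vertex $1$ and, on an edge $e$ leaving an inner vertex $i$, is one less than the number of paths $P$ from $1$ to $i$ such that some route in $C$ begins with $P$ followed by $e$. Let $\phi_0\in\mathcal F_n^{\mathbb Z}$ be the all-slack flow, $\phi_0(x_i)=i-1$ and $\phi_0(y_i)=0$. For $2\le i\le n-1$ the elementary move $m_i^+$ applies to a flow $\phi$ if $\phi(x_i)>0$ and $\phi(y_{i+1})>0$; it subtracts one from $\phi(x_i)$ and $\phi(y_{i+1})$ and adds one to $\phi(x_{i+2})$ and $\phi(y_i)$. The move $m_i^-$ applies if $\phi(x_{i+2})>0$ and $\phi(y_i)>0$; it subtracts one from $\phi(x_{i+2})$ and $\phi(y_i)$ and adds one to $\phi(x_i)$ and $\phi(y_{i+1})$. Conditions and operations on edges that do not exist are ignored. Theorem. The dual graph $D(\mathcal T_n^{\mathrm{LRL}})$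 is a subgraph of the $(n-2)$-dimensional square grid graph, whose vertex set is $\mathbb Z^{n-2}$ and in which two points are adjacent if they differ by a basis vector $\pm\mathbf e_k$. More precisely, for every maximal clique $C$ there is a sequence of elementary moves $m_{j_1}^{\epsilon_1},\dots,m_{j_l}^{\epsilon_l}$ that leads from $\phi_0$ to $\phi_C$; the lattice point $\sum_{k=1}^{l}\epsilon_k\mathbf e_{j_k-1}\in\mathbb Z^{n-2}$ does not depend on the choice of this sequence; and placing each $\Delta_C$ at this point gives an injective map from the simplices to $\mathbb Z^{n-2}$ that sends adjacent simplices to adjacent points of the grid. -/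

import Mathlib

/-! The contracted zigzag graph on the vertices `1, …, n` (for `n ≥ 2`). -/

/-- The edges of the contracted zigzag graph on `1, …, n`: `Sum.inl j` is the slack edge
`x_{j+1}` (`0 ≤ j ≤ n-2`) and `Sum.inr j` is the nonslack edge `y_j` (`0 ≤ j ≤ n-1`). -/
abbrev ZigEdge (n : ℕ) : Type := Fin (n - 1) ⊕ Fin n

namespace ZigEdge

variable {n : ℕ}

/-- `e` is the slack edge `x_i`. -/
def IsX (i : ℕ) (e : ZigEdge n) : Prop := ∃ j : Fin (n - 1), e = Sum.inl j ∧ (j : ℕ) + 1 = i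

/-- `e` is the nonslack edge `y_i`. -/
def IsY (i : ℕ) (e : ZigEdge n) : Prop := ∃ j : Fin n, e = Sum.inr j ∧ (j : ℕ) = i

/-- The initial vertex: `x_i` starts at `i`, `y_i` starts at `i`, except that `y_0` starts
at `1`. -/
def src : ZigEdge n → ℕ
  | Sum.inl j => (j : ℕ) + 1
  | Sum.inr j => if (j : ℕ) = 0 then 1 else (j : ℕ)

/-- The final vertex: `x_i` ends at `i + 1`, `y_i` ends at `i + 2`, except that `y_{n-1}` ends
at `n`. -/
def tgt : ZigEdge n → ℕ
  | Sum.inl j => (j : ℕ) + 2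
  | Sum.inr j => if (j : ℕ) = n - 1 then n else (j : ℕ) + 2

/-- The length-reverse-length framing on the incoming edges of an inner vertex `i`
(applied to two edges ending at `i`): the nonslack edge precedes the slack edge. -/
def InLt (e e' : ZigEdge n) : Prop := e.isRight = true ∧ e'.isLeft = true

/-- The length-reverse-length framing on the outgoing edges of an inner vertex `i`
(applied to two edges starting at `i`): the slack edge precedes the nonslack edge. -/
def OutLt (e e' : ZigEdge n) : Prop := e.isLeft = true ∧ e'.isRight = true

end ZigEdge

namespace Zig

open ZigEdge

/-! ### Flows -/

/-- `φ` is a (nonnegative) flow with net flow vector `a = (a 1, …, a n)`. -/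
def IsFlow {R : Type} [CommRing R] [LinearOrder R] {n : ℕ} (a : ℕ → R) (φ : ZigEdge n → R) :
    Prop :=
  (∀ e, 0 ≤ φ e) ∧
    ∀ i, 1 ≤ i → i ≤ n →
      (∑ e : ZigEdge n with tgt e = i, φ e) + a i = ∑ e : ZigEdge n with src e = i, φ e

/-- The net flow vector `(1, 0, …, 0, -1)`. -/
def unitNet (n : ℕ) (i : ℕ) : ℝ := (if i = 1 then 1 else 0) - (if i = n then 1 else 0)

/-- The flow polytope of unit flows from `1` to `n`. -/
def flowPolytope (n : ℕ) : Set (ZigEdge n → ℝ) := {φ | IsFlow (unitNet n) φ}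

/-- The in-degree of the vertex `i`. -/
def indeg (n i : ℕ) : ℕ := (Finset.univ.filter fun e : ZigEdge n => tgt e = i).card

/-- The shifted in-degree vector: `0` at the source, in-degree minus one at the inner vertices,
and minus the sum of these at the sink. -/
def shiftedIndeg (n : ℕ) (i : ℕ) : ℤ :=
  if i = 1 then 0
  else if i = n then - ∑ j ∈ Finset.Icc 2 (n - 1), ((indeg n j : ℤ) - 1)
  else (indeg n i : ℤ) - 1

/-- The integer flows whose net flow vector is the shifted in-degree vector. -/
def intFlows (n : ℕ) : Set (ZigEdge n → ℤ) := {φ | IsFlow (shiftedIndeg n) φ}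

/-- The all-slack flow: `φ(x_i) = i - 1` for `1 ≤ i ≤ n - 1`, and `φ = 0` on all nonslack
edges. -/
def slackFlow (n : ℕ) : ZigEdge n → ℤ
  | Sum.inl j => ((j : ℕ) : ℤ)
  | Sum.inr _ => 0

/-! ### Routes, coherence and the DKK triangulation -/

/-- The list of edges `l` is a directed path from `u` to `v`. -/
def IsPath {n : ℕ} : ℕ → List (ZigEdge n) → ℕ → Prop
  | u, [], v => u = v
  | u, e :: l, v => src e = u ∧ IsPath (tgt e) l v

/-- The routes: the directed paths from `1` to `n`. -/
def Route (n : ℕ) : Type := {l : List (ZigEdge n) // IsPath 1 l n}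

/-- The order on the prefixes at an inner vertex (paths from `1` to it): compare the incoming
edges at the last vertex where the two prefixes come together. -/
def PrefixLt {n : ℕ} (P P' : List (ZigEdge n)) : Prop :=
  ∃ A A' B e e', P = A ++ e :: B ∧ P' = A' ++ e' :: B ∧ InLt e e'

/-- The order on the suffixes at an inner vertex (paths from it to `n`): compare the outgoing
edges at the first vertex where the two suffixes diverge. -/
def SuffixLt {n : ℕ} (Q Q' : List (ZigEdge n)) : Prop :=
  ∃ A B B' e e', Q = A ++ e :: B ∧ Q' = A ++ e' :: B' ∧ OutLt e e'

/-- Two routes are coherent if at no common inner vertex `i` their prefixes and their suffixes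
are ordered in opposite ways. -/
def Coherent {n : ℕ} (R R' : Route n) : Prop :=
  ∀ i P Q P' Q', 2 ≤ i → i ≤ n - 1 →
    IsPath 1 P i → IsPath 1 P' i → R.1 = P ++ Q → R'.1 = P' ++ Q' →
    ¬ (PrefixLt P P' ∧ SuffixLt Q' Q) ∧ ¬ (PrefixLt P' P ∧ SuffixLt Q Q')

/-- A maximal clique: an inclusion-maximal set of pairwise coherent routes. -/
def IsMaxClique {n : ℕ} (C : Set (Route n)) : Prop :=
  Maximal (fun D : Set (Route n) => D.Pairwise Coherent) C

/-- The unit flow along a route: the sum of the basis vectors of its edges. -/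
def routeVec {n : ℕ} (R : Route n) : ZigEdge n → ℝ :=
  (R.1.map fun e => (Pi.single e 1 : ZigEdge n → ℝ)).sum

/-- Counting the edges of a path that enter and leave a given vertex. -/
theorem path_conservation {n : ℕ} (i : ℕ) (l : List (ZigEdge n)) (u v : ℕ) (h : IsPath u l v) :
    (∑ e : ZigEdge n with tgt e = i,
        (l.map fun e => (Pi.single e 1 : ZigEdge n → ℝ)).sum e) + (if i = u then 1 else 0) =
      (∑ e : ZigEdge n with src e = i,
        (l.map fun e => (Pi.single e 1 : ZigEdge n → ℝ)).sum e) + (if i = v then 1 else 0) := by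
  induction l generalizing u with
  | nil => obtain rfl : u = v := h; simp
  | cons a l ih =>
    obtain ⟨rfl, h2⟩ := h
    have := ih _ h2
    simp only [List.map_cons, List.sum_cons, Pi.add_apply, Finset.sum_add_distrib,
      Pi.single_apply, Finset.sum_ite_eq', Finset.mem_filter, Finset.mem_univ, true_and]
    simp only [eq_comm (a := i)] at this ⊢
    linarith

/-- The unit flow along a route lies in the flow polytope. -/
theorem routeVec_mem_flowPolytope {n : ℕ} (R : Route n) : routeVec R ∈ flowPolytope n := by
  refine ⟨fun e => ?_, fun i _ _ => ?_⟩
  · rw [routeVec]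
    induction R.1 with
    | nil => simp
    | cons a l ih =>
      rw [List.map_cons, List.sum_cons, Pi.add_apply, Pi.single_apply]
      split_ifs <;> linarith
  · have := path_conservation i R.1 1 n R.2
    simp only [routeVec, unitNet]
    linarith

/-- The simplex `Δ_C` of a set of routes `C`. -/
def cliqueSimplex {n : ℕ} (C : Set (Route n)) : Set (ZigEdge n → ℝ) :=
  convexHull ℝ (routeVec '' C)

/-- The (maximal simplices of the) DKK triangulation of the flow polytope for the
length-reverse-length framing. -/
def dkkTriangulation (n : ℕ) : Set (Set (ZigEdge n → ℝ)) :=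
  {Δ | ∃ C : Set (Route n), IsMaxClique C ∧ Δ = cliqueSimplex C}

/-- The simplex of a maximal clique, as a member of the triangulation. -/
def simplexOf {n : ℕ} (C : Set (Route n)) (hC : IsMaxClique C) : dkkTriangulation n :=
  ⟨cliqueSimplex C, C, hC, rfl⟩

/-- `F` is a face of codimension one of the polytope `P`. -/
def IsFacet {E : Type} [AddCommGroup E] [Module ℝ E] [TopologicalSpace E] (P F : Set E) : Prop :=
  F.Nonempty ∧ IsExposed ℝ P F ∧
    Module.finrank ℝ (vectorSpan ℝ F) + 1 = Module.finrank ℝ (vectorSpan ℝ P)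

/-- The dual graph of the triangulation: two distinct simplices are adjacent if they share a
face of codimension one. -/
def dualGraph (n : ℕ) : SimpleGraph (dkkTriangulation n) where
  Adj Δ Δ' := Δ ≠ Δ' ∧ ∃ F : Set (ZigEdge n → ℝ), IsFacet Δ.1 F ∧ IsFacet Δ'.1 F
  symm := ⟨fun _ _ ⟨hne, F, h, h'⟩ => ⟨hne.symm, F, h', h⟩⟩
  loopless := ⟨fun _ h => h.1 rfl⟩

/-- The `d`-dimensional square grid graph on `ℤ^d`: two lattice points are adjacent if they
differ by a basis vector. -/
def gridGraph (d : ℕ) : SimpleGraph (Fin d → ℤ) where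
  Adj a b := ∃ k : Fin d, b = a + Pi.single k 1 ∨ a = b + Pi.single k 1
  symm := ⟨fun _ _ ⟨k, h⟩ => ⟨k, h.symm⟩⟩
  loopless := ⟨fun a ⟨k, h⟩ => by
    have h' : a = a + Pi.single k 1 := h.elim id id
    have := congrFun h' k
    simp at this⟩

/-! ### The integer flow of a maximal clique -/

/-- The edges of the bipartite tree at the inner vertex `i` of the grove of `C`: a prefix `P`
at `i` (left vertex) is joined to an edge `e` starting at `i` (right vertex) if some route in
`C` begins with `P` followed by `e`. -/
def groveTree {n : ℕ} (C : Set (Route n)) (i : ℕ) : Set (List (ZigEdge n) × ZigEdge n) :=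
  {p | IsPath 1 p.1 i ∧ src p.2 = i ∧ ∃ R ∈ C, ∃ Q, R.1 = p.1 ++ p.2 :: Q}

/-- The integer flow of a maximal clique `C`: `0` on the edges starting at `1`; on an edge `e`
starting at an inner vertex `i`, the degree of the right vertex `e` in the tree at `i`,
minus one. -/
noncomputable def cliqueFlow {n : ℕ} (C : Set (Route n)) : ZigEdge n → ℤ := fun e =>
  if src e = 1 then 0 else (({P | (P, e) ∈ groveTree C (src e)}.ncard : ℕ) : ℤ) - 1

/-! ### Elementary moves -/

open Classical in
/-- `1` if `p` holds and `0` otherwise. -/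
noncomputable def ind (p : Prop) : ℤ := if p then 1 else 0

/-- `ψ = m_i^+(φ)`, in particular `m_i^+` applies to `φ`. Edges that do not exist are ignored. -/
def MovePlus {n : ℕ} (i : ℕ) (φ ψ : ZigEdge n → ℤ) : Prop :=
  (∀ e, IsX i e → 0 < φ e) ∧ (∀ e, IsY (i + 1) e → 0 < φ e) ∧
    ∀ e, ψ e = φ e - ind (IsX i e) - ind (IsY (i + 1) e) + ind (IsX (i + 2) e) + ind (IsY i e)

/-- `ψ = m_i^-(φ)`, in particular `m_i^-` applies to `φ`. Edges that do not exist are ignored. -/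
def MoveMinus {n : ℕ} (i : ℕ) (φ ψ : ZigEdge n → ℤ) : Prop :=
  (∀ e, IsX (i + 2) e → 0 < φ e) ∧ (∀ e, IsY i e → 0 < φ e) ∧
    ∀ e, ψ e = φ e - ind (IsX (i + 2) e) - ind (IsY i e) + ind (IsX i e) + ind (IsY (i + 1) e)

/-- A move: `(k, true)` stands for `m_{k+2}^+` and `(k, false)` for `m_{k+2}^-`; as `k` runs
through `0, …, n-3`, the index `k + 2` runs through the inner vertices `2, …, n-1`. -/
abbrev Move (n : ℕ) : Type := Fin (n - 2) × Bool

/-- `ψ` is the result of applying the move `m` to `φ`. -/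
def Applies {n : ℕ} (m : Move n) (φ ψ : ZigEdge n → ℤ) : Prop :=
  if m.2 then MovePlus ((m.1 : ℕ) + 2) φ ψ else MoveMinus ((m.1 : ℕ) + 2) φ ψ

/-- Applying the moves in the list one after the other, starting from `φ`, leads to `ψ`; all
the flows in between are integer flows in `intFlows n`. -/
def Leads {n : ℕ} : List (Move n) → (ZigEdge n → ℤ) → (ZigEdge n → ℤ) → Prop
  | [], φ, ψ => φ ∈ intFlows n ∧ φ = ψ
  | m :: s, φ, ψ => φ ∈ intFlows n ∧ ∃ χ, Applies m φ χ ∧ Leads s χ ψ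

/-- The signed sum of the basis vectors of a sequence of moves. -/
def signedSum {n : ℕ} (s : List (Move n)) : Fin (n - 2) → ℤ :=
  (s.map fun m => if m.2 then (Pi.single m.1 1 : Fin (n - 2) → ℤ) else - Pi.single m.1 1).sum

end Zig

namespace Zig

open ZigEdge

variable {n : ℕ}

/-! ### Paths -/

theorem src_lt_tgt (hn : 2 ≤ n) (e : ZigEdge n) : src e < tgt e := by
  rcases e with j | j
  · simp [src, tgt]
  · have := j.2
    simp only [src, tgt]
    split_ifs <;> omega

theorem one_le_src (e : ZigEdge n) : 1 ≤ src e := by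
  rcases e with j | j
  · simp [src]
  · simp only [src]
    split_ifs <;> omega

theorem src_lt (hn : 2 ≤ n) (e : ZigEdge n) : src e < n := by
  rcases e with j | j
  · have := j.2
    simp only [src]; omega
  · have := j.2
    simp only [src]
    split_ifs <;> omega

theorem tgt_le (hn : 2 ≤ n) (e : ZigEdge n) : tgt e ≤ n := by
  rcases e with j | j
  · have := j.2
    simp only [tgt]; omega
  · have := j.2
    simp only [tgt]
    split_ifs <;> omega

theorem isPath_append {l l' : List (ZigEdge n)} {u v : ℕ} :
    IsPath u (l ++ l') v ↔ ∃ w, IsPath u l w ∧ IsPath w l' v := by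
  induction l generalizing u with
  | nil => simp [IsPath]
  | cons e l ih => simp [IsPath, ih, and_assoc]

theorem IsPath.unique {l : List (ZigEdge n)} {u v v' : ℕ} (h : IsPath u l v)
    (h' : IsPath u l v') : v = v' := by
  induction l generalizing u with
  | nil => exact Eq.trans (Eq.symm h) h'
  | cons e l ih => exact ih h.2 h'.2

theorem isPath_concat {l : List (ZigEdge n)} {e : ZigEdge n} {u v : ℕ} :
    IsPath u (l ++ [e]) v ↔ IsPath u l (src e) ∧ tgt e = v := by
  rw [isPath_append]
  constructor
  · rintro ⟨w, h1, h2, h3⟩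
    exact ⟨h2 ▸ h1, h3⟩
  · rintro ⟨h1, h2⟩
    exact ⟨_, h1, rfl, h2⟩

theorem IsPath.le (hn : 2 ≤ n) {l : List (ZigEdge n)} {u v : ℕ} (h : IsPath u l v) : u ≤ v := by
  induction l generalizing u with
  | nil => exact le_of_eq h
  | cons e l ih =>
    have := ih h.2
    have := src_lt_tgt hn e
    have := h.1
    omega

theorem IsPath.src_ge (hn : 2 ≤ n) {l : List (ZigEdge n)} {u v : ℕ} (h : IsPath u l v) :
    ∀ e ∈ l, u ≤ src e := by
  induction l generalizing u with
  | nil => simp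
  | cons a l ih =>
    intro e he
    have h1 := h.1
    rcases List.mem_cons.1 he with rfl | he
    · omega
    · have := ih h.2 e he
      have := src_lt_tgt hn a
      omega

/-- A path between equal vertices is empty. -/
theorem IsPath.eq_nil (hn : 2 ≤ n) {l : List (ZigEdge n)} {u : ℕ} (h : IsPath u l u) :
    l = [] := by
  cases l with
  | nil => rfl
  | cons e l =>
    have := h.2.le hn
    have := src_lt_tgt hn e
    have := h.1
    omega

/-- Of two prefixes of a path, the one that ends first is a prefix of the other one. -/
theorem IsPath.prefix_of_le (hn : 2 ≤ n) {R P P' : List (ZigEdge n)} {u i i' : ℕ}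
    (h : P <+: R) (h' : P' <+: R) (hP : IsPath u P i) (hP' : IsPath u P' i') (hi : i ≤ i') :
    P <+: P' := by
  rcases List.prefix_or_prefix_of_prefix h h' with h | h
  · exact h
  · obtain ⟨Z, rfl⟩ := h
    obtain ⟨w, h1, h2⟩ := isPath_append.1 hP
    obtain rfl := h1.unique hP'
    have := h2.le hn
    obtain rfl : i = w := by omega
    rw [h2.eq_nil hn]
    simp

theorem IsPath.prefix_eq (hn : 2 ≤ n) {R P P' : List (ZigEdge n)} {u i : ℕ}
    (h : P <+: R) (h' : P' <+: R) (hP : IsPath u P i) (hP' : IsPath u P' i) : P = P' :=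
  (hP.prefix_of_le hn h h' hP' le_rfl).eq_of_length_le
    (hP'.prefix_of_le hn h' h hP le_rfl).length_le

/-! ### The order on the prefixes -/

theorem prefixLt_concat {P P' : List (ZigEdge n)} {e e' : ZigEdge n} :
    PrefixLt (P ++ [e]) (P' ++ [e']) ↔ (e = e' ∧ PrefixLt P P') ∨ InLt e e' := by
  constructor
  · rintro ⟨A, A', B, f, f', h, h', hf⟩
    rcases List.eq_nil_or_concat B with rfl | ⟨B, b, rfl⟩
    · obtain ⟨-, h⟩ := List.append_inj' h rfl
      obtain ⟨-, h'⟩ := List.append_inj' h' rfl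
      simp only [List.cons.injEq, and_true] at h h'
      subst h h'
      exact Or.inr hf
    · rw [List.concat_eq_append, ← List.cons_append, ← List.append_assoc] at h h'
      obtain ⟨h1, h⟩ := List.append_inj' h rfl
      obtain ⟨h1', h'⟩ := List.append_inj' h' rfl
      simp only [List.cons.injEq, and_true] at h h'
      exact Or.inl ⟨h.trans h'.symm, A, A', B, f, f', h1, h1', hf⟩
  · rintro (⟨rfl, A, A', B, f, f', rfl, rfl, hf⟩ | h)
    · exact ⟨A, A', B ++ [e], f, f', by simp, by simp, hf⟩
    · exact ⟨P, P', [], e, e', rfl, rfl, h⟩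

theorem not_inLt_of_inLt {e e' : ZigEdge n} (h : InLt e e') : ¬ InLt e' e ∧ e ≠ e' := by
  rcases e with e | e <;> rcases e' with e' | e' <;> simp_all [InLt]

theorem PrefixLt.asymm {P P' : List (ZigEdge n)} (h : PrefixLt P P') : ¬ PrefixLt P' P := by
  induction P using List.reverseRecOn generalizing P' with
  | nil =>
    obtain ⟨A, A', B, f, f', h, h', hf⟩ := h
    simp at h
  | append_singleton P e ih =>
    rcases List.eq_nil_or_concat P' with rfl | ⟨P', e', rfl⟩
    · obtain ⟨A, A', B, f, f', h, h', hf⟩ := h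
      simp at h'
    · rw [List.concat_eq_append, prefixLt_concat] at h ⊢
      rintro (⟨rfl, h'⟩ | h')
      · rcases h with ⟨-, h⟩ | h
        · exact ih h h'
        · exact (not_inLt_of_inLt h).2 rfl
      · rcases h with ⟨rfl, h⟩ | h
        · exact (not_inLt_of_inLt h').2 rfl
        · exact (not_inLt_of_inLt h).1 h'

theorem PrefixLt.irrefl (P : List (ZigEdge n)) : ¬ PrefixLt P P := fun h => h.asymm h

theorem PrefixLt.append {P P' : List (ZigEdge n)} (h : PrefixLt P P') (A : List (ZigEdge n)) :
    PrefixLt (P ++ A) (P' ++ A) := by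
  obtain ⟨B, B', D, e, e', rfl, rfl, h⟩ := h
  exact ⟨B, B', D ++ A, e, e', by simp, by simp, h⟩

/-! ### Layers -/

/-- The sorted list of the prefixes at the vertex `m` in the clique with slack flow `κ`.
The edge `y_0` starts at the additional vertex `0`. For `m = n` the list consists of the
routes of the clique. -/
def layer (n : ℕ) (κ : ℕ → ℕ) : ℕ → List (List (ZigEdge n))
  | 0 => [[]]
  | 1 => [[]]
  | i + 2 =>
    if h : i + 2 ≤ n then
      ((layer n κ i).drop (κ i)).map (· ++ [Sum.inr ⟨i, by omega⟩]) ++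
      (((layer n κ (i + 1)).take (κ (i + 1) + 1)).map (· ++ [Sum.inl ⟨i, by omega⟩]) ++
      if i + 2 = n then
        ((layer n κ (i + 1)).drop (κ (i + 1))).map (· ++ [Sum.inr ⟨i + 1, by omega⟩])
      else [])
    else []

/-- The prefix `P` may be continued by the edge `e` in the clique with slack flow `κ`. -/
def Allowed (κ : ℕ → ℕ) (P : List (ZigEdge n)) : ZigEdge n → Prop
  | Sum.inl j => P ∈ (layer n κ ((j : ℕ) + 1)).take (κ ((j : ℕ) + 1) + 1)
  | Sum.inr j => P ∈ (layer n κ j).drop (κ j)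

/-- The slack flow `κ` is admissible: at each vertex some prefix splits. -/
structure Admissible (n : ℕ) (κ : ℕ → ℕ) (m : ℕ) : Prop where
  zero : κ 0 = 0
  one : κ 1 = 0
  lt : ∀ i < m, κ i < (layer n κ i).length

theorem layer_eq_singleton (κ : ℕ → ℕ) {i : ℕ} (hi : i ≤ 1) : layer n κ i = [[]] := by
  interval_cases i <;> simp [layer]

theorem mem_layer_iff {κ : ℕ → ℕ} {m : ℕ} (hm : 2 ≤ m) (hmn : m ≤ n)
    {Q : List (ZigEdge n)} :
    Q ∈ layer n κ m ↔ ∃ P e, Q = P ++ [e] ∧ Allowed κ P e ∧ tgt e = m := by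
  obtain ⟨i, rfl⟩ := Nat.exists_eq_add_of_le' hm
  rw [layer, dif_pos hmn]
  simp only [List.mem_append, List.mem_map]
  constructor
  · rintro (⟨P, hP, rfl⟩ | ⟨P, hP, rfl⟩ | h)
    · refine ⟨P, _, rfl, hP, ?_⟩
      simp only [tgt]
      rw [if_neg (by omega)]
    · exact ⟨P, _, rfl, hP, rfl⟩
    · split_ifs at h with hi
      · obtain ⟨P, hP, rfl⟩ := List.mem_map.1 h
        refine ⟨P, _, rfl, hP, ?_⟩
        simp only [tgt]
        rw [if_pos (by omega), hi]
      · simp at h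
  · rintro ⟨P, j | j, rfl, hP, hj⟩
    · right; left
      obtain rfl : (j : ℕ) = i := by simpa [tgt] using hj
      exact ⟨P, hP, rfl⟩
    · simp only [tgt] at hj
      split_ifs at hj with h
      · right; right
        rw [if_pos hj.symm, List.mem_map]
        refine ⟨P, ?_, ?_⟩
        · have : i + 1 = j := by omega
          rw [this]; exact hP
        · have : (⟨i + 1, by omega⟩ : Fin n) = j := by ext; simp; omega
          rw [this]
      · left
        obtain rfl : (j : ℕ) = i := by omega
        exact ⟨P, hP, rfl⟩

/-- The layer in which the prefixes that can be continued by an edge are found. -/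
def slot : ZigEdge n → ℕ
  | Sum.inl j => (j : ℕ) + 1
  | Sum.inr j => j

theorem Allowed.mem {κ : ℕ → ℕ} {P : List (ZigEdge n)} {e : ZigEdge n} (h : Allowed κ P e) :
    P ∈ layer n κ (slot e) := by
  rcases e with j | j
  · exact List.mem_of_mem_take h
  · exact List.mem_of_mem_drop h

theorem src_eq_max (e : ZigEdge n) : src e = max 1 (slot e) := by
  rcases e with j | j
  · simp [src, slot]
  · simp only [src, slot]
    split_ifs <;> omega

theorem layer_max_one (κ : ℕ → ℕ) (i : ℕ) : layer n κ (max 1 i) = layer n κ i := by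
  rcases i with _ | i
  · rw [layer_eq_singleton κ (by simp), layer_eq_singleton κ (by simp)]
  · rw [max_eq_right (by omega)]

theorem Allowed.mem_src {κ : ℕ → ℕ} {P : List (ZigEdge n)} {e : ZigEdge n}
    (h : Allowed κ P e) : P ∈ layer n κ (src e) := by
  rw [src_eq_max, layer_max_one]; exact h.mem

theorem two_le_tgt (hn : 2 ≤ n) (e : ZigEdge n) : 2 ≤ tgt e := by
  have := src_lt_tgt hn e
  have := one_le_src e
  omega

theorem concat_mem_layer (hn : 2 ≤ n) {κ : ℕ → ℕ} {P : List (ZigEdge n)} {e : ZigEdge n} {m : ℕ}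
    (hm : 1 ≤ m) (hmn : m ≤ n) :
    P ++ [e] ∈ layer n κ m ↔ Allowed κ P e ∧ tgt e = m := by
  have h2 := two_le_tgt hn e
  rcases Nat.lt_or_ge m 2 with h | h
  · rw [layer_eq_singleton κ (by omega)]
    simp; omega
  · rw [mem_layer_iff h hmn]
    constructor
    · rintro ⟨P', e', h, h'⟩
      obtain ⟨rfl, h⟩ := List.append_inj' h rfl
      obtain rfl : e = e' := by simpa using h
      exact h'
    · exact fun h => ⟨P, e, rfl, h⟩

theorem isPath_of_mem_layer (hn : 2 ≤ n) {κ : ℕ → ℕ} {m : ℕ} (hm : 1 ≤ m) (hmn : m ≤ n)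
    {Q : List (ZigEdge n)} (h : Q ∈ layer n κ m) : IsPath 1 Q m := by
  induction Q using List.reverseRecOn generalizing m with
  | nil =>
    rcases Nat.lt_or_ge m 2 with h2 | h2
    · exact le_antisymm hm (by omega)
    · rw [mem_layer_iff h2 hmn] at h
      simp at h
  | append_singleton P e ih =>
    rw [concat_mem_layer hn hm hmn] at h
    rw [isPath_concat]
    exact ⟨ih (one_le_src e) (src_lt hn e).le h.1.mem_src, h.2⟩

/-- The layers are closed under prefixes. -/
theorem allowed_of_prefix (hn : 2 ≤ n) {κ : ℕ → ℕ} {m : ℕ} (hm : 1 ≤ m) (hmn : m ≤ n)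
    {Q P : List (ZigEdge n)} {e : ZigEdge n} (h : Q ∈ layer n κ m) (hP : P ++ [e] <+: Q) :
    Allowed κ P e := by
  induction Q using List.reverseRecOn generalizing m with
  | nil => simp at hP
  | append_singleton Q f ih =>
    rw [concat_mem_layer hn hm hmn] at h
    rcases List.prefix_concat_iff.1 hP with hP | hP
    · obtain ⟨rfl, hP⟩ := List.append_inj' hP rfl
      obtain rfl : e = f := by simpa using hP
      exact h.1
    · exact ih (one_le_src f) (src_lt hn f).le h.1.mem_src hP

theorem mem_take_or_mem_drop {α : Type*} {l : List α} {a : α} (h : a ∈ l) (k : ℕ) :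
    a ∈ l.take (k + 1) ∨ a ∈ l.drop k := by
  rw [← List.take_append_drop k l, List.mem_append] at h
  exact h.imp_left fun h => List.take_subset_take_left l (by omega) h

/-- Each prefix in a layer extends to a route in the last layer. -/
theorem exists_extension (hn : 2 ≤ n) {κ : ℕ → ℕ} {m : ℕ} (hm : 1 ≤ m) (hmn : m ≤ n)
    {P : List (ZigEdge n)} (h : P ∈ layer n κ m) : ∃ R ∈ layer n κ n, P <+: R := by
  induction hk : n - m using Nat.strong_induction_on generalizing m P with
  | _ k ih =>
  rcases hmn.eq_or_lt with rfl | hlt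
  · exact ⟨P, h, List.prefix_rfl⟩
  · have key : ∃ e : ZigEdge n, slot e = m ∧ Allowed κ P e := by
      rcases mem_take_or_mem_drop h (κ m) with h | h
      · refine ⟨Sum.inl ⟨m - 1, by omega⟩, Nat.sub_add_cancel hm, ?_⟩
        simpa only [Allowed, Nat.sub_add_cancel hm] using h
      · exact ⟨Sum.inr ⟨m, hlt⟩, rfl, h⟩
    obtain ⟨e, he, hP⟩ := key
    have h1 := src_lt_tgt hn e
    have h2 := src_eq_max e
    obtain ⟨R, hR, hPR⟩ := ih (n - tgt e) (by omega) (by have := two_le_tgt hn e; omega)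
      (tgt_le hn e)
      ((concat_mem_layer hn (by have := two_le_tgt hn e; omega) (tgt_le hn e)).2 ⟨hP, rfl⟩) rfl
    exact ⟨R, hR, (List.prefix_append _ _).trans hPR⟩

theorem allowed_iff (hn : 2 ≤ n) {κ : ℕ → ℕ} {P : List (ZigEdge n)} {e : ZigEdge n} :
    Allowed κ P e ↔ ∃ R ∈ layer n κ n, P ++ [e] <+: R := by
  constructor
  · intro h
    have := two_le_tgt hn e
    exact exists_extension hn (by omega) (tgt_le hn e)
      ((concat_mem_layer hn (by omega) (tgt_le hn e)).2 ⟨h, rfl⟩)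
  · rintro ⟨R, hR, h⟩
    exact allowed_of_prefix hn (by omega) le_rfl hR h

theorem layer_sorted {κ : ℕ → ℕ} {m : ℕ} (hmn : m < n) :
    (layer n κ m).Pairwise PrefixLt := by
  induction m using Nat.strong_induction_on with
  | _ m ih =>
  rcases Nat.lt_or_ge m 2 with h | h
  · rw [layer_eq_singleton κ (by omega)]
    simp
  · obtain ⟨i, rfl⟩ := Nat.exists_eq_add_of_le' h
    rw [layer, dif_pos hmn.le, if_neg hmn.ne, List.append_nil, List.pairwise_append]
    refine ⟨?_, ?_, ?_⟩
    · rw [List.pairwise_map]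
      exact ((ih i (by omega) (by omega)).sublist (List.drop_sublist _ _)).imp
        fun h => h.append _
    · rw [List.pairwise_map]
      exact ((ih (i + 1) (by omega) (by omega)).sublist (List.take_sublist _ _)).imp
        fun h => h.append _
    · intro a ha b hb
      obtain ⟨P, -, rfl⟩ := List.mem_map.1 ha
      obtain ⟨P', -, rfl⟩ := List.mem_map.1 hb
      exact prefixLt_concat.2 (Or.inr ⟨rfl, rfl⟩)

theorem layer_nodup {κ : ℕ → ℕ} {m : ℕ} (hmn : m < n) : (layer n κ m).Nodup :=
  (layer_sorted hmn).imp fun h => by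
    rintro rfl
    exact PrefixLt.irrefl _ h

theorem layer_congr {κ κ' : ℕ → ℕ} {m : ℕ} (h : ∀ i < m, κ i = κ' i) :
    layer n κ m = layer n κ' m := by
  induction m using Nat.strong_induction_on with
  | _ m ih =>
  rcases Nat.lt_or_ge m 2 with h2 | h2
  · rw [layer_eq_singleton κ (by omega), layer_eq_singleton κ' (by omega)]
  · obtain ⟨i, rfl⟩ := Nat.exists_eq_add_of_le' h2
    rw [layer, layer, ih i (by omega) (fun j hj => h j (by omega)),
      ih (i + 1) (by omega) (fun j hj => h j (by omega)), h i (by omega), h (i + 1) (by omega)]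

/-- The set of routes in the last layer. -/
def layerClique (n : ℕ) (κ : ℕ → ℕ) : Set (Route n) := {R | R.1 ∈ layer n κ n}

theorem not_allowed_of_prefixLt {κ : ℕ → ℕ} {P P' : List (ZigEdge n)} {a : Fin (n - 1)}
    {b : Fin n} (hab : (a : ℕ) + 1 = b) (hP : Allowed κ P (Sum.inr b))
    (hP' : Allowed κ P' (Sum.inl a)) : ¬ PrefixLt P P' := by
  simp only [Allowed, hab] at hP hP'
  obtain ⟨s, hs, rfl⟩ := List.mem_drop_iff_getElem.1 hP
  obtain ⟨t, ht, rfl⟩ := List.mem_take_iff_getElem.1 hP'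
  intro h
  have hsort := layer_sorted (κ := κ) b.2
  rcases Nat.lt_or_ge t (κ b + s) with hts | hts
  · exact h.asymm (List.pairwise_iff_getElem.1 hsort _ _ _ _ hts)
  · obtain rfl : t = κ b + s := by omega
    exact PrefixLt.irrefl _ h

theorem layerClique_coherent (hn : 2 ≤ n) (κ : ℕ → ℕ) :
    (layerClique n κ).Pairwise Coherent := by
  have key : ∀ (R R' : Route n), R ∈ layerClique n κ → R' ∈ layerClique n κ →
      ∀ i P Q P' Q', 2 ≤ i → IsPath 1 P i → IsPath 1 P' i → R.1 = P ++ Q → R'.1 = P' ++ Q' →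
      ¬ (PrefixLt P P' ∧ SuffixLt Q' Q) := by
    rintro R R' hR hR' i P Q P' Q' hi hP hP' hRP hRP' ⟨h, A, B, B', e, e', rfl, rfl, he⟩
    have h1 : Allowed κ (P ++ A) e' :=
      allowed_of_prefix hn (by omega) le_rfl hR ⟨B', by rw [hRP]; simp⟩
    have h2 : Allowed κ (P' ++ A) e :=
      allowed_of_prefix hn (by omega) le_rfl hR' ⟨B, by rw [hRP']; simp⟩
    have p1 := isPath_of_mem_layer hn (one_le_src _) (src_lt hn _).le h1.mem_src
    have p2 := isPath_of_mem_layer hn (one_le_src _) (src_lt hn _).le h2.mem_src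
    obtain ⟨w, q1, r1⟩ := isPath_append.1 p1
    obtain ⟨w', q2, r2⟩ := isPath_append.1 p2
    obtain rfl := q1.unique hP
    obtain rfl := q2.unique hP'
    have hsrc := r1.unique r2
    have hle := r1.le hn
    rcases e with a | a <;> rcases e' with b | b <;> simp [OutLt] at he
    refine not_allowed_of_prefixLt ?_ h1 h2 (h.append A)
    simp only [src] at hsrc hle
    split_ifs at hsrc hle <;> omega
  intro R hR R' hR' _ i P Q P' Q' hi hi' hP hP' hRP hRP'
  exact ⟨key R R' hR hR' i P Q P' Q' hi hP hP' hRP hRP',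
    key R' R hR' hR i P' Q' P Q hi hP' hP hRP' hRP⟩

/-- The coherence condition at the vertex at which two routes leave. -/
theorem not_prefixLt_of_coherent (hn : 2 ≤ n) {C : Set (Route n)} (hC : C.Pairwise Coherent)
    {i : ℕ} (hi : 2 ≤ i) (hin : i < n) {P P' : List (ZigEdge n)} (hP : IsPath 1 P i)
    (hP' : IsPath 1 P' i) {a : Fin (n - 1)} {b : Fin n}
    (h : ∃ R ∈ C, P ++ [Sum.inr b] <+: R.1) (h' : ∃ R ∈ C, P' ++ [Sum.inl a] <+: R.1) :
    ¬ PrefixLt P P' := by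
  obtain ⟨R, hR, Q, hQ⟩ := h
  obtain ⟨R', hR', Q', hQ'⟩ := h'
  rw [List.append_assoc, List.singleton_append] at hQ hQ'
  intro hlt
  by_cases heq : R = R'
  · subst heq
    have := IsPath.prefix_eq hn ⟨_, hQ⟩ ⟨_, hQ'⟩ hP hP'
    subst this
    exact PrefixLt.irrefl _ hlt
  · exact (hC hR hR' heq i P _ P' _ hi (by omega) hP hP' hQ.symm hQ'.symm).1
      ⟨hlt, [], Q', Q, Sum.inl a, Sum.inr b, rfl, rfl, rfl, rfl⟩

theorem exists_threshold {len : ℕ} (hlen : 0 < len) (A B : ℕ → Prop)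
    (h : ∀ s < len, ∀ t < len, A t → B s → t ≤ s) :
    ∃ v < len, (∀ t < len, A t → t ≤ v) ∧ ∀ s < len, B s → v ≤ s := by
  classical
  refine ⟨Nat.findGreatest A (len - 1), ?_, ?_, ?_⟩
  · have := Nat.findGreatest_le (P := A) (len - 1)
    omega
  · exact fun t ht hA => Nat.le_findGreatest (by omega) hA
  · intro s hs hB
    rcases Nat.eq_zero_or_pos (Nat.findGreatest A (len - 1)) with h0 | h0
    · omega
    · have hA := Nat.findGreatest_of_ne_zero rfl h0.ne'
      have := Nat.findGreatest_le (P := A) (len - 1)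
      exact h s hs _ (by omega) hA hB

theorem layer_length_pos {κ : ℕ → ℕ} {m k : ℕ} (hκ : Admissible n κ m) (hk : k ≤ m)
    (hm : k ≤ n) : 0 < (layer n κ k).length := by
  rcases Nat.lt_or_ge k 2 with h | h
  · rw [layer_eq_singleton κ (by omega)]; simp
  · obtain ⟨i, rfl⟩ := Nat.exists_eq_add_of_le' h
    have := hκ.lt i (by omega)
    rw [layer, dif_pos hm]
    simp only [List.length_append, List.length_map, List.length_drop]
    omega

theorem exists_admissible (hn : 2 ≤ n) {C : Set (Route n)} (hC : C.Pairwise Coherent) (m : ℕ)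
    (hm : m ≤ n) :
    ∃ κ, Admissible n κ m ∧ ∀ P (e : ZigEdge n), slot e < m → P ∈ layer n κ (slot e) →
      (∃ R ∈ C, P ++ [e] <+: R.1) → Allowed κ P e := by
  induction m with
  | zero => exact ⟨fun _ => 0, ⟨rfl, rfl, by simp⟩, by simp⟩
  | succ m ih =>
    obtain ⟨κ, hκ, h⟩ := ih (by omega)
    have hv : ∃ v < (layer n κ m).length, (m ≤ 1 → v = 0) ∧
        ∀ P (e : ZigEdge n), slot e = m → (∃ R ∈ C, P ++ [e] <+: R.1) →
          (e.isLeft → P ∈ layer n κ m → P ∈ (layer n κ m).take (v + 1)) ∧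
          (e.isRight → P ∈ layer n κ m → P ∈ (layer n κ m).drop v) := by
      rcases Nat.lt_or_ge m 2 with hm2 | hm2
      · refine ⟨0, ?_, fun _ => rfl, ?_⟩
        · rw [layer_eq_singleton κ (by omega)]; simp
        · intro P e _ _
          rw [layer_eq_singleton κ (by omega)]
          simp
      · have hx : m - 1 < n - 1 := by omega
        have hy : m < n := hm
        obtain ⟨v, hv, h1, h2⟩ := exists_threshold
          (layer_length_pos hκ le_rfl (by omega))
          (fun t => ∃ P, (layer n κ m)[t]? = some P ∧
            ∃ R ∈ C, P ++ [Sum.inl ⟨m - 1, hx⟩] <+: R.1)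
          (fun t => ∃ P, (layer n κ m)[t]? = some P ∧
            ∃ R ∈ C, P ++ [Sum.inr ⟨m, hy⟩] <+: R.1) (by
            rintro s hs t ht ⟨P, hP, hA⟩ ⟨P', hP', hB⟩
            by_contra hlt
            rw [List.getElem?_eq_getElem ht] at hP
            rw [List.getElem?_eq_getElem hs] at hP'
            obtain rfl := Option.some.inj hP
            obtain rfl := Option.some.inj hP'
            exact not_prefixLt_of_coherent hn hC hm2 (by omega)
              (isPath_of_mem_layer hn (by omega) (by omega) (List.getElem_mem hs))
              (isPath_of_mem_layer hn (by omega) (by omega) (List.getElem_mem ht)) hB hA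
              (List.pairwise_iff_getElem.1 (layer_sorted (by omega)) _ _ _ _ (by omega)))
        refine ⟨v, hv, by omega, ?_⟩
        intro P e he hR
        constructor
        · intro hl hP
          obtain ⟨j, rfl⟩ := Sum.isLeft_iff.1 hl
          obtain ⟨t, ht, rfl⟩ := List.getElem_of_mem hP
          have hj : j = ⟨m - 1, hx⟩ := by ext; simp only [slot] at he; simp; omega
          subst hj
          have := h1 t ht ⟨_, List.getElem?_eq_getElem ht, hR⟩
          exact List.mem_take_iff_getElem.2 ⟨t, by omega, rfl⟩
        · intro hr hP
          obtain ⟨j, rfl⟩ := Sum.isRight_iff.1 hr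
          obtain ⟨t, ht, rfl⟩ := List.getElem_of_mem hP
          have hj : j = ⟨m, hy⟩ := by ext; exact he
          subst hj
          have := h2 t ht ⟨_, List.getElem?_eq_getElem ht, hR⟩
          exact List.mem_drop_iff_getElem.2 ⟨t - v, by omega, by congr 1; omega⟩
    obtain ⟨v, hv, hv1, hv2⟩ := hv
    have hup : ∀ i < m, Function.update κ m v i = κ i := fun i hi =>
      Function.update_of_ne hi.ne _ _
    have hlay : ∀ i ≤ m, layer n (Function.update κ m v) i = layer n κ i := fun i hi =>
      layer_congr fun j hj => hup j (by omega)
    have hz : ∀ i ≤ 1, Function.update κ m v i = 0 := by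
      intro i hi
      rcases eq_or_ne i m with rfl | hne
      · rw [Function.update_self, hv1 hi]
      · rw [Function.update_of_ne hne]
        interval_cases i
        exacts [hκ.zero, hκ.one]
    refine ⟨Function.update κ m v, ⟨hz 0 (by omega), hz 1 le_rfl, ?_⟩, ?_⟩
    · intro i hi
      rw [hlay i (by omega)]
      rcases Nat.lt_succ_iff_lt_or_eq.1 hi with hi | rfl
      · rw [hup i hi]; exact hκ.lt i hi
      · rwa [Function.update_self]
    · intro P e he hP hR
      rw [hlay _ (by omega)] at hP
      rcases Nat.lt_succ_iff_lt_or_eq.1 he with he | he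
      · have := h P e he hP hR
        rcases e with j | j <;> simp only [slot] at he hP <;>
          simpa only [Allowed, hlay _ he.le, hup _ he] using this
      · have := hv2 P e he hR
        rw [he] at hP
        rcases e with j | j <;> simp only [slot] at he
        · simpa only [Allowed, hlay _ he.le, he, hlay m le_rfl, Function.update_self] using
            this.1 rfl hP
        · simpa only [Allowed, hlay _ he.le, he, hlay m le_rfl, Function.update_self] using
            this.2 rfl hP

theorem slot_lt (hn : 2 ≤ n) (e : ZigEdge n) : slot e < n := by
  have := src_lt hn e
  have := src_eq_max e
  omega

/-- The maximal cliques are the sets of routes given by the admissible slack flows. -/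
theorem exists_eq_layerClique (hn : 2 ≤ n) {C : Set (Route n)} (hC : IsMaxClique C) :
    ∃ κ, Admissible n κ n ∧ C = layerClique n κ := by
  obtain ⟨κ, hκ, h⟩ := exists_admissible hn hC.1 n le_rfl
  refine ⟨κ, hκ, hC.eq_of_subset (layerClique_coherent hn κ) ?_⟩
  intro R hR
  have key : ∀ P m, IsPath 1 P m → P <+: R.1 → P ∈ layer n κ m := by
    intro P
    induction P using List.reverseRecOn with
    | nil =>
      rintro m hm -
      rw [← show (1 : ℕ) = m from hm, layer_eq_singleton κ le_rfl]
      simp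
    | append_singleton P e ih =>
      intro m hm hP
      have hm' := isPath_concat.1 hm
      have := ih _ hm'.1 ((List.prefix_append _ _).trans hP)
      rw [src_eq_max, layer_max_one] at this
      obtain rfl := hm'.2
      have h2 := two_le_tgt hn e
      exact (concat_mem_layer hn (by omega) (tgt_le hn e)).2
        ⟨h P e (slot_lt hn e) this ⟨R, hR, hP⟩, rfl⟩
  exact key R.1 n R.2 List.prefix_rfl

/-! ### Flows in coordinates -/

/-- The value of `φ` on `x_{j+1}`, and `0` if this edge does not exist. -/
def xval {R : Type} [Zero R] (φ : ZigEdge n → R) (j : ℕ) : R :=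
  if h : j < n - 1 then φ (Sum.inl ⟨j, h⟩) else 0

/-- The value of `φ` on `y_j`, and `0` if this edge does not exist. -/
def yval {R : Type} [Zero R] (φ : ZigEdge n → R) (j : ℕ) : R :=
  if h : j < n then φ (Sum.inr ⟨j, h⟩) else 0

theorem sum_fin_ite {R : Type} [AddCommMonoid R] {m : ℕ} (g : Fin m → R) (p : Fin m → Prop)
    [DecidablePred p] (k : ℕ) (h : ∀ j, p j ↔ (j : ℕ) = k) :
    ∑ j, (if p j then g j else 0) = if h : k < m then g ⟨k, h⟩ else 0 := by
  split_ifs with hk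
  · rw [Finset.sum_eq_single ⟨k, hk⟩]
    · rw [if_pos ((h _).2 rfl)]
    · intro b _ hb
      rw [if_neg]
      exact fun hp => hb (Fin.ext ((h b).1 hp))
    · simp
  · refine Finset.sum_eq_zero fun j _ => if_neg fun hp => ?_
    have := (h j).1 hp
    omega

theorem sum_fin_ite_or {R : Type} [AddCommMonoid R] {m : ℕ} (g : Fin m → R) (p : Fin m → Prop)
    [DecidablePred p] (k l : ℕ) (hkl : k ≠ l) (h : ∀ j, p j ↔ (j : ℕ) = k ∨ (j : ℕ) = l) :
    ∑ j, (if p j then g j else 0) =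
      (if h : k < m then g ⟨k, h⟩ else 0) + if h : l < m then g ⟨l, h⟩ else 0 := by
  rw [← sum_fin_ite g (fun j => (j : ℕ) = k) k (fun _ => Iff.rfl),
    ← sum_fin_ite g (fun j => (j : ℕ) = l) l (fun _ => Iff.rfl), ← Finset.sum_add_distrib]
  refine Finset.sum_congr rfl fun j _ => ?_
  have := h j
  by_cases h1 : (j : ℕ) = k
  · rw [if_pos (this.2 (Or.inl h1)), if_pos h1, if_neg (by omega), add_zero]
  · by_cases h2 : (j : ℕ) = l
    · rw [if_pos (this.2 (Or.inr h2)), if_pos h2, if_neg h1, zero_add]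
    · rw [if_neg (by tauto), if_neg h1, if_neg h2, add_zero]

theorem sum_tgt_inner {R : Type} [AddCommMonoid R] (φ : ZigEdge n → R) {j : ℕ}
    (hj : j + 2 < n) :
    ∑ e : ZigEdge n with tgt e = j + 2, φ e = xval φ j + yval φ j := by
  rw [Finset.sum_filter, Fintype.sum_sum_type, sum_fin_ite _ _ j, sum_fin_ite _ _ j]
  · rfl
  · intro i
    simp only [tgt]
    split_ifs <;> omega
  · intro i
    simp [tgt]

theorem sum_tgt_last {R : Type} [AddCommMonoid R] (φ : ZigEdge n → R) {j : ℕ}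
    (hj : j + 2 = n) :
    ∑ e : ZigEdge n with tgt e = j + 2, φ e = xval φ j + (yval φ j + yval φ (j + 1)) := by
  rw [Finset.sum_filter, Fintype.sum_sum_type, sum_fin_ite _ _ j,
    sum_fin_ite_or _ _ j (j + 1) (by omega)]
  · rfl
  · intro i
    simp only [tgt]
    split_ifs <;> omega
  · intro i
    simp only [tgt]
    omega

theorem sum_tgt_first {R : Type} [AddCommMonoid R] (hn : 2 ≤ n) (φ : ZigEdge n → R) :
    ∑ e : ZigEdge n with tgt e = 1, φ e = 0 := by
  rw [Finset.filter_false_of_mem, Finset.sum_empty]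
  intro e _
  have := two_le_tgt hn e
  omega

theorem sum_src_inner {R : Type} [AddCommMonoid R] (φ : ZigEdge n → R) (j : ℕ) :
    ∑ e : ZigEdge n with src e = j + 2, φ e = xval φ (j + 1) + yval φ (j + 2) := by
  rw [Finset.sum_filter, Fintype.sum_sum_type, sum_fin_ite _ _ (j + 1), sum_fin_ite _ _ (j + 2)]
  · rfl
  · intro i
    simp only [src]
    split_ifs <;> omega
  · intro i
    simp [src]

theorem sum_src_first {R : Type} [AddCommMonoid R] (φ : ZigEdge n → R) :
    ∑ e : ZigEdge n with src e = 1, φ e = xval φ 0 + (yval φ 0 + yval φ 1) := by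
  rw [Finset.sum_filter, Fintype.sum_sum_type, sum_fin_ite _ _ 0,
    sum_fin_ite_or _ _ 0 1 (by omega)]
  · rfl
  · intro i
    simp only [src]
    split_ifs <;> omega
  · intro i
    simp [src]

theorem indeg_inner {j : ℕ} (hj : j + 2 < n) : indeg n (j + 2) = 2 := by
  rw [indeg, Finset.card_eq_sum_ones, sum_tgt_inner (fun _ => 1) hj, xval, yval,
    dif_pos (by omega), dif_pos (by omega)]

theorem shiftedIndeg_inner {j : ℕ} (hj : j + 2 < n) : shiftedIndeg n (j + 2) = 1 := by
  rw [shiftedIndeg, if_neg (by omega), if_neg hj.ne, indeg_inner hj]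
  norm_num

theorem shiftedIndeg_last (hn : 2 ≤ n) : shiftedIndeg n n = -((n : ℤ) - 2) := by
  rw [shiftedIndeg, if_neg (by omega), if_pos rfl, Finset.sum_congr rfl (g := fun _ => (1 : ℤ))]
  · rw [Finset.sum_const, Nat.card_Icc, nsmul_eq_mul, mul_one]
    omega
  · intro j hj
    rw [Finset.mem_Icc] at hj
    obtain ⟨i, rfl⟩ := Nat.exists_eq_add_of_le' hj.1
    rw [indeg_inner (by omega)]
    norm_num

/-- Conservation at the vertex `n` follows from conservation at the other vertices. -/
theorem last_conservation {φ : ZigEdge n → ℤ} (h1 : xval φ 0 + yval φ 0 + yval φ 1 = 0)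
    (h2 : ∀ j, j + 2 < n → xval φ j + yval φ j + 1 = xval φ (j + 1) + yval φ (j + 2)) (j : ℕ)
    (hj : j + 1 < n) : xval φ j + yval φ j + yval φ (j + 1) = j := by
  induction j with
  | zero => simpa using h1
  | succ j ih =>
    have := ih (by omega)
    have := h2 j (by omega)
    push_cast
    rw [show j + 1 + 1 = j + 2 from rfl]
    linarith

theorem mem_intFlows_iff (hn : 2 ≤ n) (φ : ZigEdge n → ℤ) :
    φ ∈ intFlows n ↔ (∀ e, 0 ≤ φ e) ∧ xval φ 0 + yval φ 0 + yval φ 1 = 0 ∧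
      ∀ j, j + 2 < n → xval φ j + yval φ j + 1 = xval φ (j + 1) + yval φ (j + 2) := by
  refine and_congr_right fun _ => ⟨fun h => ⟨?_, fun j hj => ?_⟩, ?_⟩
  · have := h 1 le_rfl (by omega)
    rw [sum_tgt_first hn, sum_src_first, shiftedIndeg, if_pos rfl] at this
    linarith
  · have := h (j + 2) (by omega) hj.le
    rwa [sum_tgt_inner φ hj, sum_src_inner, shiftedIndeg_inner hj] at this
  · rintro ⟨h1, h2⟩ i hi hin
    rcases hi.eq_or_lt with rfl | hi
    · rw [sum_tgt_first hn, sum_src_first, shiftedIndeg, if_pos rfl]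
      linarith
    · obtain ⟨j, rfl⟩ := Nat.exists_eq_add_of_le' hi
      change ∑ e : ZigEdge n with tgt e = j + 2, φ e + shiftedIndeg n (j + 2) =
        ∑ e : ZigEdge n with src e = j + 2, φ e
      rcases hin.eq_or_lt with hin | hin
      · have hs : shiftedIndeg n (j + 2) = -((n : ℤ) - 2) := by
          rw [← shiftedIndeg_last hn, ← hin]
        have hlast := last_conservation h1 h2 j (by omega)
        have hcast : (n : ℤ) = j + 2 := by rw [← hin]; rfl
        rw [hs, sum_src_inner, sum_tgt_last φ hin, xval.eq_def _ (j + 1), yval.eq_def _ (j + 2),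
          dif_neg (by omega), dif_neg (by omega), hcast]
        linarith
      · rw [sum_tgt_inner φ hin, sum_src_inner, shiftedIndeg_inner hin, h2 j hin]

/-! ### Moves -/

theorem ind_isX (i : ℕ) (e : ZigEdge n) :
    ind (IsX i e) = match e with
      | Sum.inl j => if (j : ℕ) + 1 = i then 1 else 0
      | Sum.inr _ => 0 := by
  rcases e with j | j <;> simp [ind, IsX]

theorem ind_isY (i : ℕ) (e : ZigEdge n) :
    ind (IsY i e) = match e with
      | Sum.inl _ => 0
      | Sum.inr j => if (j : ℕ) = i then 1 else 0 := by
  rcases e with j | j <;> simp [ind, IsY]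

/-- `ψ` arises from `φ` by `d` times the elementary move at `k + 2`. -/
def MoveBy (d : ℤ) (k : ℕ) (φ ψ : ZigEdge n → ℤ) : Prop :=
  (∀ j, j + 1 < n → xval ψ j =
    xval φ j + d * ((if j = k + 3 then 1 else 0) - (if j = k + 1 then 1 else 0))) ∧
  ∀ j, j < n → yval ψ j =
    yval φ j + d * ((if j = k + 2 then 1 else 0) - (if j = k + 3 then 1 else 0))

theorem moveBy_iff (d : ℤ) (k : ℕ) (φ ψ : ZigEdge n → ℤ) :
    MoveBy d k φ ψ ↔ ∀ e, ψ e = φ e + d * (ind (IsX (k + 2 + 2) e) + ind (IsY (k + 2) e)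
      - ind (IsX (k + 2) e) - ind (IsY (k + 2 + 1) e)) := by
  constructor
  · rintro ⟨h1, h2⟩ (⟨j, hj⟩ | ⟨j, hj⟩)
    · have := h1 j (by omega)
      rw [xval, xval, dif_pos hj, dif_pos hj] at this
      rw [this]
      simp only [ind_isX, ind_isY, add_zero, sub_zero]
      congr 3 <;> congr 1 <;> simp only [eq_iff_iff] <;> omega
    · have := h2 j hj
      rw [yval, yval, dif_pos hj, dif_pos hj] at this
      rw [this]
      simp only [ind_isX, ind_isY, zero_add, sub_zero]
  · intro h
    constructor
    · intro j hj
      rw [xval, xval, dif_pos (by omega), dif_pos (by omega), h]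
      simp only [ind_isX, ind_isY, add_zero, sub_zero]
      congr 3 <;> congr 1 <;> simp only [eq_iff_iff] <;> omega
    · intro j hj
      rw [yval, yval, dif_pos hj, dif_pos hj, h]
      simp only [ind_isX, ind_isY, zero_add, sub_zero]

theorem MoveBy.mem_intFlows (hn : 2 ≤ n) {d : ℤ} {k : ℕ}
    {φ ψ : ZigEdge n → ℤ} (h : MoveBy d k φ ψ) (hφ : φ ∈ intFlows n) (hψ : ∀ e, 0 ≤ ψ e) :
    ψ ∈ intFlows n := by
  rw [mem_intFlows_iff hn] at hφ ⊢
  obtain ⟨-, h1, h2⟩ := hφ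
  refine ⟨hψ, ?_, fun j hj => ?_⟩
  · rw [h.1 0 (by omega), h.2 0 (by omega), h.2 1 (by omega)]
    simpa using h1
  · have := h2 j hj
    rw [h.1 j (by omega), h.2 j (by omega), h.1 (j + 1) (by omega), h.2 (j + 2) (by omega)]
    have e1 : (j + 1 = k + 3) ↔ (j = k + 2) := by omega
    have e2 : (j + 1 = k + 1) ↔ (j = k) := by omega
    have e3 : (j + 2 = k + 2) ↔ (j = k) := by omega
    have e4 : (j + 2 = k + 3) ↔ (j = k + 1) := by omega
    simp only [e1, e2, e3, e4]
    linear_combination this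

/-- The `k`-th coordinate of the lattice point of a flow. -/
def coord (φ : ZigEdge n → ℤ) (k : ℕ) : ℤ := ∑ j ∈ Finset.range (k + 1), yval φ (j + 2)

theorem coord_zero (φ : ZigEdge n → ℤ) : coord φ 0 = yval φ 2 := by simp [coord]

theorem coord_succ (φ : ZigEdge n → ℤ) (k : ℕ) :
    coord φ (k + 1) = coord φ k + yval φ (k + 3) := by
  rw [coord, Finset.sum_range_succ]; rfl

theorem MoveBy.coord_eq {d : ℤ} {k : ℕ} {φ ψ : ZigEdge n → ℤ} (h : MoveBy d k φ ψ) {l : ℕ}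
    (hl : l + 2 < n) : coord ψ l = coord φ l + if l = k then d else 0 := by
  induction l with
  | zero =>
    rw [coord_zero, coord_zero, h.2 2 (by omega)]
    split_ifs <;> omega
  | succ l ih =>
    rw [coord_succ, coord_succ, ih (by omega), h.2 (l + 3) (by omega)]
    split_ifs <;> omega

theorem Applies.moveBy {m : Move n} {φ ψ : ZigEdge n → ℤ} (h : Applies m φ ψ) :
    MoveBy (if m.2 then 1 else -1) m.1 φ ψ := by
  rw [moveBy_iff]
  intro e
  rw [Applies] at h
  split_ifs at h ⊢
  · rw [h.2.2 e]; ring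
  · rw [h.2.2 e]; ring

theorem Leads.coord_eq {s : List (Move n)} {φ ψ : ZigEdge n → ℤ} (h : Leads s φ ψ)
    (k : Fin (n - 2)) : coord ψ k = coord φ k + signedSum s k := by
  induction s generalizing φ with
  | nil =>
    obtain rfl := h.2
    simp [signedSum]
  | cons m s ih =>
    obtain ⟨-, χ, h1, h2⟩ := h
    rw [ih h2, h1.moveBy.coord_eq (by omega)]
    simp only [signedSum, List.map_cons, List.sum_cons, Pi.add_apply]
    rw [add_assoc]
    congr 2
    rcases m with ⟨i, b⟩
    have : (k : ℕ) = i ↔ k = i := Fin.ext_iff.symm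
    rcases b <;> simp only [Bool.false_eq_true, if_true, if_false, this, Pi.neg_apply,
      Pi.single_apply]
    split_ifs <;> simp

theorem Leads.concat {s : List (Move n)} {m : Move n} {φ χ ψ : ZigEdge n → ℤ} (h : Leads s φ χ)
    (hm : Applies m χ ψ) (hψ : ψ ∈ intFlows n) : Leads (s ++ [m]) φ ψ := by
  induction s generalizing φ with
  | nil =>
    obtain ⟨h, rfl⟩ := h
    exact ⟨h, ψ, hm, hψ, rfl⟩
  | cons a s ih =>
    obtain ⟨h, χ', h1, h2⟩ := h
    exact ⟨h, χ', h1, ih h2⟩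

theorem slackFlow_coord (k : ℕ) : coord (slackFlow n) k = 0 :=
  Finset.sum_eq_zero fun j _ => by
    rw [yval]
    split_ifs <;> rfl

theorem xval_nonneg {φ : ZigEdge n → ℤ} (h : ∀ e, 0 ≤ φ e) (j : ℕ) : 0 ≤ xval φ j := by
  rw [xval]; split_ifs
  exacts [h _, le_rfl]

theorem yval_nonneg {φ : ZigEdge n → ℤ} (h : ∀ e, 0 ≤ φ e) (j : ℕ) : 0 ≤ yval φ j := by
  rw [yval]; split_ifs
  exacts [h _, le_rfl]

theorem coord_nonneg {φ : ZigEdge n → ℤ} (h : ∀ e, 0 ≤ φ e) (k : ℕ) : 0 ≤ coord φ k :=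
  Finset.sum_nonneg fun _ _ => yval_nonneg h _

theorem ext_val {φ ψ : ZigEdge n → ℤ} (hx : ∀ j, j + 1 < n → xval φ j = xval ψ j)
    (hy : ∀ j, j < n → yval φ j = yval ψ j) : φ = ψ := by
  funext e
  rcases e with ⟨j, hj⟩ | ⟨j, hj⟩
  · simpa [xval, hj] using hx j (by omega)
  · simpa [yval, hj] using hy j hj

theorem first_values (hn : 2 ≤ n) {φ : ZigEdge n → ℤ} (h : φ ∈ intFlows n) :
    xval φ 0 = 0 ∧ yval φ 0 = 0 ∧ yval φ 1 = 0 := by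
  obtain ⟨h0, h1, -⟩ := (mem_intFlows_iff hn φ).1 h
  have := xval_nonneg h0 0
  have := yval_nonneg h0 0
  have := yval_nonneg h0 1
  refine ⟨?_, ?_, ?_⟩ <;> linarith

/-- An integer flow is determined by its values on the nonslack edges. -/
theorem ext_of_yval (hn : 2 ≤ n) {φ ψ : ZigEdge n → ℤ} (hφ : φ ∈ intFlows n)
    (hψ : ψ ∈ intFlows n) (h : ∀ j, j + 2 < n → yval φ (j + 2) = yval ψ (j + 2)) : φ = ψ := by
  obtain ⟨a1, a2, a3⟩ := first_values hn hφ
  obtain ⟨b1, b2, b3⟩ := first_values hn hψ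
  have hy : ∀ j, j < n → yval φ j = yval ψ j
    | 0, _ => a2.trans b2.symm
    | 1, _ => a3.trans b3.symm
    | j + 2, hj => h j hj
  refine ext_val (fun j hj => ?_) hy
  induction j with
  | zero => rw [a1, b1]
  | succ j ih =>
    have h1 := ((mem_intFlows_iff hn φ).1 hφ).2.2 j (by omega)
    have h2 := ((mem_intFlows_iff hn ψ).1 hψ).2.2 j (by omega)
    have := ih (by omega)
    have := hy j (by omega)
    have := hy (j + 2) (by omega)
    linarith

theorem ext_of_coord (hn : 2 ≤ n) {φ ψ : ZigEdge n → ℤ} (hφ : φ ∈ intFlows n)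
    (hψ : ψ ∈ intFlows n) (h : ∀ k, k + 2 < n → coord φ k = coord ψ k) : φ = ψ := by
  refine ext_of_yval hn hφ hψ fun j hj => ?_
  rcases j with _ | j
  · simpa only [coord_zero] using h 0 hj
  · have h1 := h (j + 1) hj
    have h2 := h j (by omega)
    rw [coord_succ, coord_succ] at h1
    rw [show j + 1 + 2 = j + 3 from rfl]
    linarith

theorem slackFlow_mem (hn : 2 ≤ n) : slackFlow n ∈ intFlows n := by
  rw [mem_intFlows_iff hn]
  refine ⟨?_, ?_, ?_⟩
  · rintro (j | j) <;> simp [slackFlow]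
  · simp [xval, yval, slackFlow]
  · intro j hj
    rw [xval, yval, xval, yval, dif_pos (by omega), dif_pos (by omega), dif_pos (by omega),
      dif_pos (by omega)]
    simp [slackFlow]

/-- Every integer flow other than the all-slack flow arises by a move with a positive sign. -/
theorem exists_movePlus (hn : 2 ≤ n) {φ : ZigEdge n → ℤ} (hφ : φ ∈ intFlows n)
    (hne : φ ≠ slackFlow n) :
    ∃ (k : Fin (n - 2)) (ψ : ZigEdge n → ℤ), ψ ∈ intFlows n ∧ Applies (k, true) ψ φ := by
  classical
  obtain ⟨h0, -, h2⟩ := (mem_intFlows_iff hn φ).1 hφ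
  have hex : ∃ j, j + 2 < n ∧ 0 < yval φ (j + 2) := by
    by_contra hcon
    push Not at hcon
    refine hne (ext_of_yval hn hφ (slackFlow_mem hn) fun j hj => ?_)
    rw [le_antisymm (hcon j hj) (yval_nonneg h0 _), yval, dif_pos hj]
    rfl
  obtain ⟨j₀, hj₀⟩ := hex
  obtain ⟨k, ⟨hk, hpos⟩, hmax⟩ : ∃ k, (k + 2 < n ∧ 0 < yval φ (k + 2)) ∧
      ∀ j, k < j → ¬ (j + 2 < n ∧ 0 < yval φ (j + 2)) := by
    have hs := Nat.findGreatest_spec (P := fun j => j + 2 < n ∧ 0 < yval φ (j + 2))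
      (show j₀ ≤ n by omega) hj₀
    refine ⟨_, hs, fun j hj hjP => ?_⟩
    exact absurd hjP (Nat.findGreatest_is_greatest hj (by omega))
  have hx : k + 4 < n → 0 < xval φ (k + 3) := by
    intro hk4
    have h1 := h2 (k + 2) hk4
    have h3 := hmax (k + 2) (by omega)
    have := xval_nonneg h0 (k + 2)
    have : ¬ 0 < yval φ (k + 2 + 2) := fun h => h3 ⟨hk4, h⟩
    rw [show k + 2 + 1 = k + 3 from rfl] at h1
    linarith
  let ψ : ZigEdge n → ℤ := fun e => φ e + (-1) * (ind (IsX (k + 2 + 2) e) + ind (IsY (k + 2) e)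
      - ind (IsX (k + 2) e) - ind (IsY (k + 2 + 1) e))
  have hψ : MoveBy (-1) k φ ψ := (moveBy_iff _ _ _ _).2 fun _ => rfl
  have hψ0 : ∀ e, 0 ≤ ψ e := by
    rintro (⟨j, hj⟩ | ⟨j, hj⟩)
    · have := h0 (Sum.inl ⟨j, hj⟩)
      simp only [ψ, ind_isX, ind_isY]
      have hxj : j + 1 = k + 2 + 2 → 0 < φ (Sum.inl ⟨j, hj⟩) := by
        intro h
        obtain rfl : j = k + 3 := by omega
        have := hx (by omega)
        rwa [xval, dif_pos hj] at this
      split_ifs <;> omega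
    · have := h0 (Sum.inr ⟨j, hj⟩)
      simp only [ψ, ind_isX, ind_isY]
      have hyj : j = k + 2 → 0 < φ (Sum.inr ⟨j, hj⟩) := by
        rintro rfl
        rwa [yval, dif_pos hj] at hpos
      split_ifs <;> omega
  refine ⟨⟨k, by omega⟩, ψ, hψ.mem_intFlows hn hφ hψ0, ?_⟩
  rw [Applies, if_pos rfl]
  refine ⟨?_, ?_, ?_⟩
  · rintro e ⟨j, rfl, hj⟩
    have := h0 (Sum.inl j)
    simp only [ψ, ind_isX, ind_isY]
    simp only at hj
    rw [if_neg (by omega), if_pos hj]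
    omega
  · rintro e ⟨j, rfl, hj⟩
    have := h0 (Sum.inr j)
    simp only [ψ, ind_isX, ind_isY]
    simp only at hj
    rw [if_neg (by omega), if_pos hj]
    omega
  · intro e
    simp only [ψ]
    ring

/-- Every integer flow is reached from the all-slack flow by elementary moves. -/
theorem exists_leads (hn : 2 ≤ n) {φ : ZigEdge n → ℤ} (hφ : φ ∈ intFlows n) :
    ∃ s : List (Move n), Leads s (slackFlow n) φ := by
  induction hk : (∑ k : Fin (n - 2), coord φ k).toNat using Nat.strong_induction_on
    generalizing φ with
  | _ N ih =>
  by_cases hne : φ = slackFlow n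
  · exact ⟨[], slackFlow_mem hn, hne.symm⟩
  · obtain ⟨k, ψ, hψ, happ⟩ := exists_movePlus hn hφ hne
    have hsum : ∑ l : Fin (n - 2), coord φ l = ∑ l : Fin (n - 2), coord ψ l + 1 := by
      have : ∀ l : Fin (n - 2), coord φ l = coord ψ l + if l = k then 1 else 0 := by
        intro l
        rw [happ.moveBy.coord_eq (by omega)]
        simp only [if_true, Fin.ext_iff]
      rw [Finset.sum_congr rfl fun l _ => this l, Finset.sum_add_distrib]
      simp
    have hnonneg : 0 ≤ ∑ l : Fin (n - 2), coord ψ l :=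
      Finset.sum_nonneg fun l _ => coord_nonneg hψ.1 _
    obtain ⟨s, hs⟩ := ih _ (by omega) hψ rfl
    exact ⟨s ++ [(k, true)], hs.concat happ hφ⟩

/-! ### The flow of a clique -/

theorem mem_groveTree_iff (hn : 2 ≤ n) {κ : ℕ → ℕ} {P : List (ZigEdge n)} {e : ZigEdge n} :
    (P, e) ∈ groveTree (layerClique n κ) (src e) ↔ Allowed κ P e := by
  constructor
  · rintro ⟨-, -, R, hR, Q, hQ⟩
    exact (allowed_iff hn).2 ⟨R.1, hR, Q, by rw [hQ]; simp⟩
  · intro h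
    obtain ⟨R, hR, Q, hQ⟩ := (allowed_iff hn).1 h
    exact ⟨isPath_of_mem_layer hn (one_le_src e) (src_lt hn e).le h.mem_src, rfl,
      ⟨R, isPath_of_mem_layer hn (by omega) le_rfl hR⟩, hR, Q, by change R = _; rw [← hQ]; simp⟩

theorem ncard_mem_list {α : Type*} {l : List α} (h : l.Nodup) :
    {a | a ∈ l}.ncard = l.length := by
  classical
  rw [← List.toFinset_card_of_nodup h, ← Set.ncard_coe_finset]
  simp

theorem cliqueFlow_inl (hn : 2 ≤ n) {κ : ℕ → ℕ} (hκ : Admissible n κ n) (j : Fin (n - 1)) :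
    cliqueFlow (layerClique n κ) (Sum.inl j) = κ (j + 1) := by
  rw [cliqueFlow]
  split_ifs with h
  · obtain h : (j : ℕ) = 0 := by simpa [src] using h
    rw [h, hκ.one]; rfl
  · simp only [mem_groveTree_iff hn, Allowed]
    rw [ncard_mem_list ((layer_nodup (by omega)).sublist (List.take_sublist _ _)),
      List.length_take, min_eq_left (hκ.lt _ (by omega))]
    simp

theorem cliqueFlow_inr (hn : 2 ≤ n) {κ : ℕ → ℕ} (hκ : Admissible n κ n) (j : Fin n) :
    cliqueFlow (layerClique n κ) (Sum.inr j) = (layer n κ j).length - κ j - 1 := by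
  rw [cliqueFlow]
  split_ifs with h
  · have h : (j : ℕ) ≤ 1 := by
      simp only [src] at h
      split_ifs at h <;> omega
    rw [layer_eq_singleton κ h]
    have : κ j = 0 := by
      generalize (j : ℕ) = i at h
      interval_cases i
      exacts [hκ.zero, hκ.one]
    simp [this]
  · simp only [mem_groveTree_iff hn, Allowed]
    rw [ncard_mem_list ((layer_nodup j.2).sublist (List.drop_sublist _ _)), List.length_drop,
      Nat.cast_sub (hκ.lt _ j.2).le]

theorem length_layer {κ : ℕ → ℕ} (hκ : Admissible n κ n) {j : ℕ} (hj : j + 2 < n) :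
    ((layer n κ (j + 2)).length : ℤ) = (layer n κ j).length - κ j + κ (j + 1) + 1 := by
  rw [layer, dif_pos hj.le, if_neg hj.ne, List.append_nil, List.length_append, List.length_map,
    List.length_map, List.length_drop, List.length_take, min_eq_left (hκ.lt _ (by omega))]
  have := hκ.lt j (by omega)
  omega

theorem xval_cliqueFlow (hn : 2 ≤ n) {κ : ℕ → ℕ} (hκ : Admissible n κ n) {j : ℕ}
    (hj : j + 1 < n) : xval (cliqueFlow (layerClique n κ)) j = κ (j + 1) := by
  rw [xval, dif_pos (by omega), cliqueFlow_inl hn hκ]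

theorem yval_cliqueFlow (hn : 2 ≤ n) {κ : ℕ → ℕ} (hκ : Admissible n κ n) {j : ℕ} (hj : j < n) :
    yval (cliqueFlow (layerClique n κ)) j = (layer n κ j).length - κ j - 1 := by
  rw [yval, dif_pos hj, cliqueFlow_inr hn hκ]

theorem cliqueFlow_mem (hn : 2 ≤ n) {κ : ℕ → ℕ} (hκ : Admissible n κ n) :
    cliqueFlow (layerClique n κ) ∈ intFlows n := by
  rw [mem_intFlows_iff hn]
  refine ⟨?_, ?_, ?_⟩
  · rintro (j | j)
    · rw [cliqueFlow_inl hn hκ]; positivity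
    · rw [cliqueFlow_inr hn hκ]
      have := hκ.lt j j.2
      omega
  · rw [xval_cliqueFlow hn hκ (by omega), yval_cliqueFlow hn hκ (by omega),
      yval_cliqueFlow hn hκ (by omega), layer_eq_singleton κ (by omega),
      layer_eq_singleton κ (by omega), hκ.zero, hκ.one]
    simp
  · intro j hj
    rw [xval_cliqueFlow hn hκ (by omega), yval_cliqueFlow hn hκ (by omega),
      xval_cliqueFlow hn hκ (by omega), yval_cliqueFlow hn hκ (by omega), length_layer hκ hj]
    ring

/-- The coordinates of a clique in terms of its slack flow. -/
theorem coord_cliqueFlow (hn : 2 ≤ n) {κ : ℕ → ℕ} (hκ : Admissible n κ n) {k : ℕ}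
    (hk : k + 2 < n) :
    coord (cliqueFlow (layerClique n κ)) k + κ (k + 2) =
      k + 1 + if 2 ≤ k then coord (cliqueFlow (layerClique n κ)) (k - 2) else 0 := by
  have hφ := cliqueFlow_mem hn hκ
  obtain ⟨a1, a2, a3⟩ := first_values hn hφ
  have h := ((mem_intFlows_iff hn _).1 hφ).2.2
  have hx : ∀ j, j + 1 < n → xval (cliqueFlow (layerClique n κ)) j = κ (j + 1) :=
    fun j hj => xval_cliqueFlow hn hκ hj
  rw [show (κ (k + 2) : ℤ) = _ from (hx (k + 1) (by omega)).symm]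
  generalize cliqueFlow (layerClique n κ) = φ at *
  induction k with
  | zero =>
    have := h 0 hk
    simp only [coord_zero]
    simp only [zero_add] at this ⊢
    simp
    linarith
  | succ k ih =>
    have h1 := h (k + 1) hk
    have h2 := ih (by omega)
    rw [coord_succ]
    rw [show k + 1 + 2 = k + 3 from rfl] at h1
    rcases k with _ | _ | k
    · simp at h1 h2 ⊢
      linarith
    · simp [coord_zero] at h1 h2 ⊢
      linarith
    · have e : coord φ (k + 1 + 1 + 1 - 2) = coord φ k + yval φ (k + 3) := coord_succ φ k
      rw [if_pos (by omega), e]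
      rw [if_pos (by omega), show k + 1 + 1 - 2 = k by omega] at h2
      push_cast at h1 h2 ⊢
      rw [show k + 1 + 1 + 1 = k + 3 from rfl] at *
      linarith

/-! ### Linear independence of the routes of a clique -/

open Classical in
theorem routeVec_apply (hn : 2 ≤ n) (R : Route n) (e : ZigEdge n) :
    routeVec R e = if e ∈ R.1 then 1 else 0 := by
  have key : ∀ (l : List (ZigEdge n)) (u v : ℕ), IsPath u l v →
      (l.map fun e => (Pi.single e 1 : ZigEdge n → ℝ)).sum e = if e ∈ l then 1 else 0 := by
    intro l
    induction l with
    | nil => simp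
    | cons a l ih =>
      intro u v h
      rw [List.map_cons, List.sum_cons, Pi.add_apply, ih _ _ h.2, Pi.single_apply]
      by_cases he : e = a
      · subst he
        have : e ∉ l := fun hl => by
          have := h.2.src_ge hn e hl
          have := src_lt_tgt hn e
          omega
        simp [this]
      · simp [he]
  exact key R.1 1 n R.2

theorem mem_iff_exists_prefix {l : List (ZigEdge n)} {e : ZigEdge n} :
    e ∈ l ↔ ∃ P, P ++ [e] <+: l := by
  constructor
  · intro h
    obtain ⟨s, t, rfl⟩ := List.append_of_mem h
    exact ⟨s, t, by simp⟩
  · rintro ⟨P, Q, rfl⟩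
    simp

/-- Only one prefix splits at a vertex. -/
theorem eq_of_allowed {κ : ℕ → ℕ} {P P' : List (ZigEdge n)} {a : Fin (n - 1)} {b : Fin n}
    (hab : (a : ℕ) + 1 = b) (h1 : Allowed κ P (Sum.inl a)) (h2 : Allowed κ P (Sum.inr b))
    (h1' : Allowed κ P' (Sum.inl a)) (h2' : Allowed κ P' (Sum.inr b)) : P = P' := by
  have key : ∀ Q : List (ZigEdge n), Allowed κ Q (Sum.inl a) → Allowed κ Q (Sum.inr b) →
      (layer n κ b)[κ b]? = some Q := by
    intro Q h1 h2
    simp only [Allowed, hab] at h1 h2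
    obtain ⟨t, ht, h1⟩ := List.mem_take_iff_getElem.1 h1
    obtain ⟨s, hs, h2⟩ := List.mem_drop_iff_getElem.1 h2
    rw [← h2, List.Nodup.getElem_inj_iff (layer_nodup b.2)] at h1
    obtain rfl : s = 0 := by omega
    rw [← h2]
    exact List.getElem?_eq_getElem _
  exact Option.some.inj ((key P h1 h2).symm.trans (key P' h1' h2'))

theorem edges_at_inner (hn : 2 ≤ n) {e : ZigEdge n} (he : 2 ≤ src e) :
    ∃ (a : Fin (n - 1)) (b : Fin n), (a : ℕ) + 1 = b ∧ src e = b ∧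
      ∀ e' : ZigEdge n, src e' = b ↔ e' = Sum.inl a ∨ e' = Sum.inr b := by
  have hlt := src_lt hn e
  generalize src e = m at he hlt
  refine ⟨⟨m - 1, by omega⟩, ⟨m, hlt⟩, Nat.sub_add_cancel (by omega), rfl, ?_⟩
  rintro (⟨j, hj⟩ | ⟨j, hj⟩)
  · simp only [src, Sum.inl.injEq, Fin.mk.injEq, reduceCtorEq, or_false]
    omega
  · simp only [src, Sum.inr.injEq, Fin.mk.injEq, reduceCtorEq, false_or]
    split_ifs <;> omega

open Classical in
/-- The total weight of the routes that begin with `P`. -/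
noncomputable def prefixSum {C : Set (Route n)} (s : Finset C) (g : C → ℝ)
    (P : List (ZigEdge n)) : ℝ :=
  ∑ R ∈ s, if P <+: R.1.1 then g R else 0

theorem exists_of_prefixSum_ne_zero {C : Set (Route n)} {s : Finset C} {g : C → ℝ}
    {P : List (ZigEdge n)} (h : prefixSum s g P ≠ 0) : ∃ R ∈ C, P <+: R.1 := by
  obtain ⟨R, -, hR⟩ := Finset.exists_ne_zero_of_sum_ne_zero h
  exact ⟨R.1, R.2, by by_contra hP; exact hR (if_neg hP)⟩

theorem prefixSum_split {C : Set (Route n)} (s : Finset C) (g : C → ℝ)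
    {P : List (ZigEdge n)} {m : ℕ} (hP : IsPath 1 P m) (hm : m < n) {e f : ZigEdge n}
    (hef : e ≠ f) (h : ∀ e' : ZigEdge n, src e' = m ↔ e' = e ∨ e' = f) :
    prefixSum s g P = prefixSum s g (P ++ [e]) + prefixSum s g (P ++ [f]) := by
  rw [prefixSum, prefixSum, prefixSum, ← Finset.sum_add_distrib]
  refine Finset.sum_congr rfl fun R _ => ?_
  by_cases hR : P <+: R.1.1
  · rw [if_pos hR]
    obtain ⟨Q, hQ⟩ := hR
    have hpath := R.1.2
    rw [← hQ] at hpath ⊢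
    obtain ⟨w, h1, h2⟩ := isPath_append.1 hpath
    obtain rfl := h1.unique hP
    rcases Q with _ | ⟨e', Q⟩
    · have : w = n := h2
      omega
    · simp only [List.prefix_append_right_inj, List.cons_prefix_cons, List.nil_prefix, and_true]
      rcases (h e').1 h2.1 with rfl | rfl
      · rw [if_pos rfl, if_neg (Ne.symm hef), add_zero]
      · rw [if_neg hef, if_pos rfl, zero_add]
  · rw [if_neg hR, if_neg, if_neg, add_zero]
    · exact fun h => hR ((List.prefix_append _ _).trans h)
    · exact fun h => hR ((List.prefix_append _ _).trans h)

theorem layerClique_linearIndependent (hn : 2 ≤ n) (κ : ℕ → ℕ) :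
    LinearIndependent ℝ fun R : layerClique n κ => routeVec R.1 := by
  classical
  rw [linearIndependent_iff']
  intro s g hg
  have hcoord : ∀ e : ZigEdge n, ∑ R ∈ s, (if e ∈ R.1.1 then g R else 0) = 0 := by
    intro e
    refine Eq.trans ?_ (congrFun hg e)
    rw [Finset.sum_apply]
    refine Finset.sum_congr rfl fun R _ => ?_
    rw [Pi.smul_apply, routeVec_apply hn, smul_eq_mul, mul_ite, mul_one,
      mul_zero]
  have hzero : ∀ (P : List (ZigEdge n)) (e : ZigEdge n), IsPath 1 P (src e) →
      prefixSum s g (P ++ [e]) = 0 := by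
    intro P e hP
    induction hm : src e using Nat.strong_induction_on generalizing P e with
    | _ m ih =>
    subst hm
    rcases Nat.lt_or_ge (src e) 2 with h2 | h2
    · have h1 : src e = 1 := by have := one_le_src e; omega
      rw [h1] at hP
      rw [hP.eq_nil hn, ← hcoord e, prefixSum]
      refine Finset.sum_congr rfl fun R _ => ?_
      congr 1
      rw [mem_iff_exists_prefix, eq_iff_iff]
      refine ⟨fun h => ⟨_, h⟩, fun ⟨Q, Z, hQ⟩ => ?_⟩
      have hpath := R.1.2
      rw [← hQ, List.append_assoc] at hpath
      obtain ⟨w, q1, q2⟩ := isPath_append.1 hpath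
      have q3 : src e = w := q2.1
      rw [← q3, h1] at q1
      obtain rfl := q1.eq_nil hn
      exact ⟨Z, hQ⟩
    · obtain ⟨a, b, hab, hb, hall⟩ := edges_at_inner hn h2
      have hP0 : ∀ P, IsPath 1 P b → prefixSum s g P = 0 := by
        intro P hP
        rcases List.eq_nil_or_concat P with rfl | ⟨P, f, rfl⟩
        · have : 1 = (b : ℕ) := hP
          omega
        · rw [List.concat_eq_append] at hP ⊢
          rw [isPath_concat] at hP
          have := src_lt_tgt hn f
          exact ih _ (by omega) P f hP.1 rfl
      have hboth : ∀ P, IsPath 1 P b → prefixSum s g (P ++ [e]) ≠ 0 →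
          Allowed κ P (Sum.inl a) ∧ Allowed κ P (Sum.inr b) := by
        intro P hP hne
        have hsp := prefixSum_split s g hP b.2 Sum.inl_ne_inr hall
        rw [hP0 P hP] at hsp
        have h1 : prefixSum s g (P ++ [Sum.inl a]) ≠ 0 ∧
            prefixSum s g (P ++ [Sum.inr b]) ≠ 0 := by
          rcases (hall e).1 hb with rfl | rfl
          · exact ⟨hne, fun h => hne (by linarith)⟩
          · exact ⟨fun h => hne (by linarith), hne⟩
        obtain ⟨R, hR, hPR⟩ := exists_of_prefixSum_ne_zero h1.1
        obtain ⟨R', hR', hPR'⟩ := exists_of_prefixSum_ne_zero h1.2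
        exact ⟨(allowed_iff hn).2 ⟨_, hR, hPR⟩, (allowed_iff hn).2 ⟨_, hR', hPR'⟩⟩
      by_contra hne
      rw [hb] at hP
      have hPb := hboth P hP hne
      have hmem : ∀ (P : List (ZigEdge n)), ∀ R : layerClique n κ, P ++ [e] <+: R.1.1 →
          P ∈ layer n κ b := fun P R h => hb ▸
        ((allowed_iff hn).2 ⟨R.1.1, R.2, h⟩).mem_src
      have hsum : ∑ P' ∈ (layer n κ b).toFinset, prefixSum s g (P' ++ [e]) = 0 := by
        rw [← hcoord e]
        simp only [prefixSum]
        rw [Finset.sum_comm]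
        refine Finset.sum_congr rfl fun R _ => ?_
        split_ifs with heR
        · obtain ⟨P', hP'⟩ := mem_iff_exists_prefix.1 heR
          rw [Finset.sum_eq_single P', if_pos hP']
          · intro P'' hP'' hne
            refine if_neg fun h => hne ?_
            have q1 := isPath_of_mem_layer hn (by omega) b.2.le (hmem _ _ h)
            have q2 := isPath_of_mem_layer hn (by omega) b.2.le (hmem _ _ hP')
            exact q1.prefix_eq hn ((List.prefix_append _ _).trans h)
              ((List.prefix_append _ _).trans hP') q2
          · exact fun h => absurd (List.mem_toFinset.2 (hmem _ _ hP')) h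
        · refine Finset.sum_eq_zero fun P' _ => if_neg fun h => heR ?_
          exact mem_iff_exists_prefix.2 ⟨_, h⟩
      rw [Finset.sum_eq_single P] at hsum
      · exact hne hsum
      · intro P' hP' hne'
        by_contra h
        rw [List.mem_toFinset] at hP'
        have := hboth P' (isPath_of_mem_layer hn (by omega) b.2.le hP') h
        exact hne' (eq_of_allowed hab this.1 this.2 hPb.1 hPb.2)
      · intro h
        refine absurd (List.mem_toFinset.2 ?_) h
        have := hPb.1.mem
        rwa [slot, hab] at this
  intro R hR
  have hlast : prefixSum s g R.1.1 = g R := by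
    rw [prefixSum, Finset.sum_eq_single R, if_pos List.prefix_rfl]
    · intro R' _ hne
      refine if_neg fun h => hne (Subtype.ext (Subtype.ext ?_))
      exact IsPath.prefix_eq hn List.prefix_rfl h R'.1.2 R.1.2
    · exact fun h => absurd hR h
  rw [← hlast]
  have hpath := R.1.2
  rcases List.eq_nil_or_concat R.1.1 with h | ⟨P, e, h⟩
  · rw [h] at hpath
    have : 1 = n := hpath
    omega
  · rw [List.concat_eq_append] at h
    rw [h] at hpath ⊢
    exact hzero P e (isPath_concat.1 hpath).1

/-! ### Facets of the simplices -/

theorem layerClique_finite (κ : ℕ → ℕ) : (layerClique n κ).Finite :=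
  Set.Finite.preimage Subtype.val_injective.injOn (List.finite_toSet (layer n κ n))

theorem routeVec_injective (hn : 2 ≤ n) : Function.Injective (routeVec (n := n)) := by
  classical
  intro R R' h
  have hmem : ∀ e, e ∈ R.1 ↔ e ∈ R'.1 := by
    intro e
    have := congrFun h e
    rw [routeVec_apply hn, routeVec_apply hn] at this
    split_ifs at this <;> simp_all
  have hsort : ∀ (l : List (ZigEdge n)) (u v : ℕ), IsPath u l v →
      l.Pairwise fun e e' => src e < src e' := by
    intro l
    induction l with
    | nil => simp
    | cons a l ih =>
      intro u v h
      refine List.pairwise_cons.2 ⟨fun e he => ?_, ih _ _ h.2⟩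
      exact (src_lt_tgt hn a).trans_le (h.2.src_ge hn e he)
  have hnd : ∀ l : List (ZigEdge n), (l.Pairwise fun e e' => src e < src e') → l.Nodup :=
    fun l hl => hl.imp fun h => by rintro rfl; exact lt_irrefl _ h
  have s1 := hsort _ _ _ R.2
  have s2 := hsort _ _ _ R'.2
  exact Subtype.ext (List.Perm.eq_of_pairwise (fun a b _ _ h h' => absurd h h'.asymm) s1 s2
    ((List.perm_ext_iff_of_nodup (hnd _ s1) (hnd _ s2)).2 hmem))

/-- The routes that are vertices of a set. -/
def vertexRoutes (F : Set (ZigEdge n → ℝ)) : Set (Route n) :=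
  {R | routeVec R ∈ F.extremePoints ℝ}

theorem finrank_vectorSpan_routes (hn : 2 ≤ n) {κ : ℕ → ℕ} {K : Set (Route n)}
    (hK : K ⊆ layerClique n κ) (hne : K.Nonempty) :
    Module.finrank ℝ (vectorSpan ℝ (convexHull ℝ (routeVec '' K))) + 1 = K.ncard := by
  have hfin : K.Finite := (layerClique_finite κ).subset hK
  have : Fintype K := hfin.fintype
  have hind : AffineIndependent ℝ fun R : K => routeVec R.1 :=
    (layerClique_linearIndependent hn κ).affineIndependent.comp_embedding
      (Set.embeddingOfSubset _ _ hK)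
  have hpos : 0 < K.ncard := (Set.ncard_pos hfin).2 hne
  have hcard : Fintype.card K = (K.ncard - 1) + 1 := by
    rw [← Nat.card_eq_fintype_card, Nat.card_coe_set_eq]; omega
  have := hind.finrank_vectorSpan hcard
  rw [← direction_affineSpan, affineSpan_convexHull, direction_affineSpan, Set.image_eq_range,
    this]
  omega

theorem eq_convexHull_vertexRoutes {κ : ℕ → ℕ} {F : Set (ZigEdge n → ℝ)}
    (hF : IsExtreme ℝ (cliqueSimplex (layerClique n κ)) F) (hconv : Convex ℝ F)
    (hcomp : IsCompact F) (hn : 2 ≤ n) :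
    vertexRoutes F ⊆ layerClique n κ ∧ F = convexHull ℝ (routeVec '' vertexRoutes F) := by
  have hsub : F.extremePoints ℝ ⊆ routeVec '' layerClique n κ :=
    hF.extremePoints_subset_extremePoints.trans extremePoints_convexHull_subset
  have himg : routeVec '' vertexRoutes F = F.extremePoints ℝ := by
    refine Set.Subset.antisymm (Set.image_subset_iff.2 fun R h => h) fun x hx => ?_
    obtain ⟨R, -, rfl⟩ := hsub hx
    exact ⟨R, hx, rfl⟩
  refine ⟨fun R hR => ?_, ?_⟩
  · obtain ⟨R', hR', h⟩ := hsub hR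
    rwa [← routeVec_injective hn h]
  · have hfin : (F.extremePoints ℝ).Finite := ((layerClique_finite κ).image _).subset hsub
    rw [himg]
    conv_lhs => rw [← closure_convexHull_extremePoints hcomp hconv]
    exact (hfin.isClosed_convexHull ℝ).closure_eq

theorem layerClique_nonempty (hn : 2 ≤ n) (κ : ℕ → ℕ) : (layerClique n κ).Nonempty := by
  obtain ⟨R, hR, -⟩ := exists_extension hn (κ := κ) (m := 1) le_rfl (by omega) (P := [])
    (by rw [layer_eq_singleton κ le_rfl]; simp)
  exact ⟨⟨R, isPath_of_mem_layer hn (by omega) le_rfl hR⟩, hR⟩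

theorem isCompact_cliqueSimplex (κ : ℕ → ℕ) :
    IsCompact (cliqueSimplex (layerClique n κ)) :=
  ((layerClique_finite κ).image _).isCompact_convexHull ℝ

/-- All routes of a clique are vertices of its simplex. -/
theorem vertexRoutes_cliqueSimplex (hn : 2 ≤ n) (κ : ℕ → ℕ) :
    vertexRoutes (cliqueSimplex (layerClique n κ)) = layerClique n κ := by
  obtain ⟨hsub, heq⟩ := eq_convexHull_vertexRoutes (κ := κ) IsExtreme.rfl
    (convex_convexHull ℝ _) (isCompact_cliqueSimplex κ) hn
  have hne := layerClique_nonempty hn κ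
  have hne' : (vertexRoutes (cliqueSimplex (layerClique n κ))).Nonempty := by
    by_contra h
    rw [Set.not_nonempty_iff_eq_empty] at h
    rw [h, Set.image_empty, convexHull_empty, cliqueSimplex, convexHull_eq_empty,
      Set.image_eq_empty] at heq
    exact hne.ne_empty heq
  refine Set.eq_of_subset_of_ncard_le hsub ?_ (layerClique_finite κ)
  rw [← finrank_vectorSpan_routes hn hsub hne', ← finrank_vectorSpan_routes hn subset_rfl hne,
    ← heq]
  rfl

/-- A facet of the simplex of a clique misses exactly one route. -/
theorem IsFacet.exists_insert (hn : 2 ≤ n) {κ : ℕ → ℕ} {F : Set (ZigEdge n → ℝ)}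
    (h : IsFacet (cliqueSimplex (layerClique n κ)) F) :
    ∃ R ∉ vertexRoutes F, insert R (vertexRoutes F) = layerClique n κ := by
  obtain ⟨hne, hexp, hrank⟩ := h
  obtain ⟨hsub, heq⟩ := eq_convexHull_vertexRoutes hexp.isExtreme
    (hexp.convex (convex_convexHull ℝ _)) (hexp.isCompact (isCompact_cliqueSimplex κ)) hn
  have hne' : (vertexRoutes F).Nonempty := by
    by_contra h
    rw [Set.not_nonempty_iff_eq_empty] at h
    rw [h, Set.image_empty, convexHull_empty] at heq
    exact hne.ne_empty heq
  have hfin := (layerClique_finite κ).subset hsub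
  refine (Set.exists_eq_insert_iff_ncard hfin).2 ⟨hsub, ?_⟩
  rw [← finrank_vectorSpan_routes hn hsub hne',
    ← finrank_vectorSpan_routes hn subset_rfl (layerClique_nonempty hn κ), ← heq, hrank]
  rfl

/-! ### Cliques that differ in one route -/

theorem layer_add_two {κ : ℕ → ℕ} {i : ℕ} (h : i + 2 < n) :
    layer n κ (i + 2) =
      ((layer n κ i).drop (κ i)).map (· ++ [Sum.inr ⟨i, by omega⟩]) ++
      ((layer n κ (i + 1)).take (κ (i + 1) + 1)).map (· ++ [Sum.inl ⟨i, by omega⟩]) := by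
  rw [layer, dif_pos h.le, if_neg h.ne, List.append_nil]

theorem allowed_inl_iff {κ : ℕ → ℕ} {k : ℕ} (hk : k + 1 < n) {t : ℕ} {P : List (ZigEdge n)}
    (h : (layer n κ (k + 1))[t]? = some P) :
    Allowed κ P (Sum.inl ⟨k, by omega⟩) ↔ t ≤ κ (k + 1) := by
  obtain ⟨ht, rfl⟩ := List.getElem?_eq_some_iff.1 h
  simp only [Allowed, List.mem_take_iff_getElem]
  constructor
  · rintro ⟨s, hs, h⟩
    rw [List.Nodup.getElem_inj_iff (layer_nodup hk)] at h
    omega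
  · exact fun h => ⟨t, by omega, rfl⟩

theorem allowed_inr_iff {κ : ℕ → ℕ} {k : ℕ} (hk : k < n) {t : ℕ} {P : List (ZigEdge n)}
    (h : (layer n κ k)[t]? = some P) :
    Allowed κ P (Sum.inr ⟨k, hk⟩) ↔ κ k ≤ t := by
  obtain ⟨ht, rfl⟩ := List.getElem?_eq_some_iff.1 h
  simp only [Allowed, List.mem_drop_iff_getElem]
  constructor
  · rintro ⟨s, hs, h⟩
    rw [List.Nodup.getElem_inj_iff (layer_nodup hk)] at h
    omega
  · exact fun h => ⟨t - κ k, by omega, by congr 1; omega⟩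

/-- At most the route `r` of the clique with slack flow `κ` begins with `Q`. -/
def OnlyRoute (n : ℕ) (κ : ℕ → ℕ) (r Q : List (ZigEdge n)) : Prop :=
  ∀ R ∈ layer n κ n, Q <+: R → R = r

theorem OnlyRoute.mono {κ : ℕ → ℕ} {r Q Q' : List (ZigEdge n)} (h : OnlyRoute n κ r Q)
    (hQ : Q <+: Q') : OnlyRoute n κ r Q' :=
  fun R hR hQR => h R hR (hQ.trans hQR)

/-- Every route of the clique with slack flow `κ` other than `r` belongs to the clique with
slack flow `κ'`. -/
def DiffersBy (n : ℕ) (κ κ' : ℕ → ℕ) (r : List (ZigEdge n)) : Prop :=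
  ∀ R ∈ layer n κ n, R ∉ layer n κ' n → R = r

theorem DiffersBy.of_not_allowed (hn : 2 ≤ n) {κ κ' : ℕ → ℕ} {r P : List (ZigEdge n)}
    {e : ZigEdge n} (h : DiffersBy n κ κ' r) (h1 : Allowed κ P e) (h2 : ¬ Allowed κ' P e) :
    P ++ [e] <+: r ∧ OnlyRoute n κ r (P ++ [e]) := by
  have h3 : OnlyRoute n κ r (P ++ [e]) := fun R hR hP =>
    h R hR fun hR' => h2 ((allowed_iff hn).2 ⟨R, hR', hP⟩)
  obtain ⟨R, hR, hP⟩ := (allowed_iff hn).1 h1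
  exact ⟨h3 R hR hP ▸ hP, h3⟩

/-- At least two routes pass through a prefix that splits. -/
theorem not_onlyRoute_of_splits (hn : 2 ≤ n) {κ : ℕ → ℕ} {k : ℕ} (hk : k + 1 < n)
    {P r : List (ZigEdge n)} (h : (layer n κ (k + 1))[κ (k + 1)]? = some P) :
    ¬ OnlyRoute n κ r P := by
  intro ho
  obtain ⟨R, hR, h1⟩ := (allowed_iff hn).1 ((allowed_inl_iff hk h).2 le_rfl)
  obtain ⟨R', hR', h2⟩ := (allowed_iff hn).1 ((allowed_inr_iff hk h).2 le_rfl)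
  rw [ho R hR ((List.prefix_append _ _).trans h1)] at h1
  rw [ho R' hR' ((List.prefix_append _ _).trans h2)] at h2
  have := (List.prefix_of_prefix_length_le h1 h2 (by simp)).eq_of_length (by simp)
  simp at this

/-- If a prefix splits in one clique but not in the other one, then the additional route
passes through it. -/
theorem DiffersBy.prefix_of_splits (hn : 2 ≤ n) {κ κ' : ℕ → ℕ} {r P : List (ZigEdge n)}
    (h : DiffersBy n κ κ' r) {k t : ℕ} (hk : k + 1 < n)
    (h1 : (layer n κ (k + 1))[κ (k + 1)]? = some P) (h2 : (layer n κ' (k + 1))[t]? = some P)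
    (ht : t ≠ κ' (k + 1)) : P <+: r := by
  rcases lt_or_gt_of_ne ht with ht | ht
  · have := h.of_not_allowed hn ((allowed_inr_iff hk h1).2 le_rfl)
      (by rw [allowed_inr_iff hk h2]; omega)
    exact (List.prefix_append _ _).trans this.1
  · have := h.of_not_allowed hn ((allowed_inl_iff hk h1).2 le_rfl)
      (by rw [allowed_inl_iff hk h2]; omega)
    exact (List.prefix_append _ _).trans this.1

/-- Equality of two prefixes, up to prefixes that begin with `u`. -/
def RelUpTo (u P P' : List (ZigEdge n)) : Prop := P = P' ∨ u <+: P

theorem RelUpTo.append {u P P' : List (ZigEdge n)} (h : RelUpTo u P P') (Q : List (ZigEdge n)) :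
    RelUpTo u (P ++ Q) (P' ++ Q) :=
  h.imp (fun h => by rw [h]) fun h => h.trans (List.prefix_append _ _)

theorem forall₂_relUpTo_append {u : List (ZigEdge n)} {l l' : List (List (ZigEdge n))}
    (h : List.Forall₂ (RelUpTo u) l l') (Q : List (ZigEdge n)) :
    List.Forall₂ (RelUpTo u) (l.map (· ++ Q)) (l'.map (· ++ Q)) :=
  List.rel_map (fun _ _ h => h.append Q) h

theorem forall₂_relUpTo_refl (u : List (ZigEdge n)) (l : List (List (ZigEdge n))) :
    List.Forall₂ (RelUpTo u) l l :=
  List.forall₂_same.2 fun _ _ => Or.inl rfl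

theorem forall₂_layer {κ κ' : ℕ → ℕ} {u : List (ZigEdge n)} {j : ℕ} (hj : j + 2 < n)
    (h1 : List.Forall₂ (RelUpTo u) ((layer n κ j).drop (κ j)) ((layer n κ' j).drop (κ' j)))
    (h2 : List.Forall₂ (RelUpTo u) (layer n κ (j + 1)) (layer n κ' (j + 1)))
    (h3 : κ (j + 1) = κ' (j + 1)) :
    List.Forall₂ (RelUpTo u) (layer n κ (j + 2)) (layer n κ' (j + 2)) := by
  rw [layer_add_two hj, layer_add_two hj, ← h3]
  exact List.rel_append (forall₂_relUpTo_append h1 _)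
    (forall₂_relUpTo_append (List.forall₂_take _ h2) _)

theorem DiffersBy.eq_of_forall₂ (hn : 2 ≤ n) {κ κ' : ℕ → ℕ} (hκ : Admissible n κ n)
    {r u : List (ZigEdge n)} (h : DiffersBy n κ κ' r) (hur : u <+: r)
    (hu : OnlyRoute n κ r u) {j m : ℕ} (hum : IsPath 1 u m) (hmj : m ≤ j + 1) (hj : j + 1 < n)
    (hrel : List.Forall₂ (RelUpTo u) (layer n κ (j + 1)) (layer n κ' (j + 1))) :
    κ (j + 1) = κ' (j + 1) := by
  have hlt := hκ.lt _ hj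
  have hP := List.getElem?_eq_getElem hlt
  have hlt' : κ (j + 1) < (layer n κ' (j + 1)).length := hrel.length_eq ▸ hlt
  have hP' := List.getElem?_eq_getElem hlt'
  have hno := not_onlyRoute_of_splits hn hj hP (r := r)
  rcases (List.forall₂_iff_get.1 hrel).2 _ hlt hlt' with heq | hpre
  · simp only [List.get_eq_getElem] at heq
    by_contra hne
    rw [← heq] at hP'
    have hpr := h.prefix_of_splits hn hj hP hP' hne
    exact hno (hu.mono (hum.prefix_of_le hn hur hpr
      (isPath_of_mem_layer hn (by omega) (by omega) (List.getElem_mem hlt)) hmj))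
  · exact (hno (hu.mono hpre)).elim

/-- Two cliques that differ in one route, and whose slack flows agree below the vertex `k + 2`,
differ by an elementary move. -/
theorem move_of_differsBy (hn : 2 ≤ n) {κ κ' : ℕ → ℕ} (hκ : Admissible n κ n)
    (hκ' : Admissible n κ' n) {r r' : List (ZigEdge n)} (h : DiffersBy n κ κ' r)
    (h' : DiffersBy n κ' κ r') {k : ℕ} (hk : k + 2 < n) (hlow : ∀ j < k + 2, κ j = κ' j)
    (hlt : κ (k + 2) < κ' (k + 2)) {j : ℕ} (hj : j < n) :
    κ j + (if j = k + 2 then 1 else 0) = κ' j + (if j = k + 4 then 1 else 0) := by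
  have hlay : ∀ j ≤ k + 2, layer n κ j = layer n κ' j := fun j hj =>
    layer_congr fun i hi => hlow i (by omega)
  have hl := hκ.lt (k + 2) hk
  have hl' := hκ'.lt (k + 2) hk
  rw [← hlay _ le_rfl] at hl'
  have hpath : ∀ {κ : ℕ → ℕ} {m : ℕ} (_ : 1 ≤ m) (_ : m < n) {t : ℕ}
      (ht : t < (layer n κ m).length), IsPath 1 (layer n κ m)[t] m := fun hm hmn _ ht =>
    isPath_of_mem_layer hn hm hmn.le (List.getElem_mem ht)
  have hdiff : ∀ {t : ℕ} (ht : t < (layer n κ (k + 2)).length), κ (k + 2) ≤ t →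
      t < κ' (k + 2) →
      (layer n κ (k + 2))[t] ++ [Sum.inr ⟨k + 2, hk⟩] <+: r ∧
        OnlyRoute n κ r ((layer n κ (k + 2))[t] ++ [Sum.inr ⟨k + 2, hk⟩]) := by
    intro t ht h1 h2
    have hP := List.getElem?_eq_getElem ht
    refine h.of_not_allowed hn ((allowed_inr_iff hk hP).2 h1) ?_
    have hP' : (layer n κ' (k + 2))[t]? = some (layer n κ (k + 2))[t] := by
      rw [← hlay _ le_rfl]; exact hP
    rw [allowed_inr_iff hk hP']
    omega
  obtain ⟨hur, hu⟩ := hdiff hl le_rfl hlt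
  have hone : κ' (k + 2) = κ (k + 2) + 1 := by
    have h2 := (hdiff (t := κ' (k + 2) - 1) (by omega) (by omega) (by omega)).1
    have := (hpath (by omega) hk hl).prefix_eq hn ((List.prefix_append _ _).trans hur)
      ((List.prefix_append _ _).trans h2) (hpath (by omega) hk _)
    rw [List.Nodup.getElem_inj_iff (layer_nodup hk)] at this
    omega
  have hl2 : κ (k + 2) + 1 < (layer n κ (k + 2)).length := by omega
  set u := (layer n κ (k + 2))[κ (k + 2)] ++ [Sum.inr ⟨k + 2, hk⟩]
  set w := (layer n κ (k + 2))[κ (k + 2) + 1] ++ [Sum.inl ⟨k + 1, by omega⟩]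
  obtain ⟨hwr, hw⟩ : w <+: r' ∧ OnlyRoute n κ' r' w := by
    have hP := List.getElem?_eq_getElem hl2
    refine h'.of_not_allowed hn ?_ ?_
    · have hP' : (layer n κ' (k + 2))[κ (k + 2) + 1]? =
          some (layer n κ (k + 2))[κ (k + 2) + 1] := by
        rw [← hlay _ le_rfl]; exact hP
      rw [allowed_inl_iff hk hP']
      exact hone.ge
    · rw [allowed_inl_iff hk hP]
      simp
  rcases Nat.lt_or_ge j (k + 2) with hj1 | hj1
  · rw [hlow j hj1, if_neg (by omega), if_neg (by omega)]
  rcases hj1.eq_or_lt with rfl | hj1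
  · rw [if_pos rfl, if_neg (by omega), hone]
  -- the vertex `k + 3`
  have hk3 : k + 3 < n := by omega
  have hwpath : IsPath 1 w (k + 3) :=
    isPath_concat.2 ⟨hpath (by omega) hk hl2, rfl⟩
  have hupath : IsPath 1 u (k + 4) := by
    refine isPath_concat.2 ⟨?_, ?_⟩
    · simpa [src] using hpath (by omega) hk hl
    · simp only [tgt]
      rw [if_neg (by omega)]
  have hlay3 : layer n κ' (k + 3) = layer n κ (k + 3) ++ [w] := by
    rw [show k + 3 = (k + 1) + 2 from rfl, layer_add_two hk3, layer_add_two hk3,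
      ← hlay (k + 1) (by omega), ← hlow (k + 1) (by omega), show k + 1 + 1 = k + 2 from rfl,
      ← hlay (k + 2) le_rfl, hone, ← List.take_append_getElem hl2, List.map_append,
      List.append_assoc]
    rfl
  have hκ3 : κ (k + 3) = κ' (k + 3) := by
    by_contra hne
    have hl3 := hκ.lt _ hk3
    have hP := List.getElem?_eq_getElem hl3
    have hP' : (layer n κ' (k + 3))[κ (k + 3)]? = some (layer n κ (k + 3))[κ (k + 3)] := by
      rw [hlay3, List.getElem?_append_left hl3, hP]
    have hpr := h.prefix_of_splits hn hk3 hP hP' hne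
    have hPp := hpath (by omega) hk3 hl3
    have hpu := hPp.prefix_of_le hn hpr hur hupath (by omega)
    rcases List.prefix_concat_iff.1 hpu with heq | hpre
    · rw [heq] at hPp
      have := hPp.unique hupath
      omega
    · obtain ⟨Z, hZ⟩ := hpre
      have hq := hpath (by omega) hk hl
      rw [← hZ, isPath_append] at hq
      obtain ⟨m, h1, h2⟩ := hq
      obtain rfl := h1.unique hPp
      have := h2.le hn
      omega
  rcases (show k + 3 ≤ j from hj1).eq_or_lt with rfl | hj2
  · rw [if_neg (by omega), if_neg (by omega), hκ3]
  -- the vertex `k + 4`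
  have hk4 : k + 4 < n := by omega
  have hl3 := hκ.lt _ hk3
  have hlay4 : layer n κ (k + 4) = u :: layer n κ' (k + 4) := by
    rw [show k + 4 = (k + 2) + 2 from rfl, layer_add_two hk4, layer_add_two hk4,
      ← hlay (k + 2) le_rfl, show k + 2 + 1 = k + 3 from rfl, hlay3, hone, ← hκ3,
      List.take_append_of_le_length hl3, List.drop_eq_getElem_cons hl]
    rfl
  have hκ4 : κ (k + 4) = κ' (k + 4) + 1 := by
    by_contra hne
    have hl4 := hκ'.lt _ hk4
    have hP := List.getElem?_eq_getElem hl4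
    have hP' : (layer n κ (k + 4))[κ' (k + 4) + 1]? =
        some (layer n κ' (k + 4))[κ' (k + 4)] := by
      rw [hlay4, List.getElem?_cons_succ, hP]
    have hpr := h'.prefix_of_splits hn hk4 hP hP' (Ne.symm hne)
    exact not_onlyRoute_of_splits hn hk4 hP (hw.mono (hwpath.prefix_of_le hn hwr hpr
      (hpath (by omega) hk4 hl4) (by omega)))
  rcases (show k + 4 ≤ j from hj2).eq_or_lt with rfl | hj3
  · rw [if_neg (by omega), if_pos rfl, hκ4]
  -- the vertices above `k + 4`
  rw [if_neg (by omega), if_neg (by omega), add_zero, add_zero]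
  have key : ∀ i, k + i + 5 < n →
      List.Forall₂ (RelUpTo u) (layer n κ (k + i + 5)) (layer n κ' (k + i + 5)) ∧
        κ (k + i + 5) = κ' (k + i + 5) := by
    intro i
    induction i using Nat.strong_induction_on with
    | _ i ih =>
    intro hi
    suffices hrel : List.Forall₂ (RelUpTo u) (layer n κ (k + i + 5)) (layer n κ' (k + i + 5)) from
      ⟨hrel, h.eq_of_forall₂ hn hκ hur hu hupath (by omega) hi hrel⟩
    rcases i with _ | _ | i
    · change List.Forall₂ (RelUpTo u) (layer n κ (k + 3 + 2)) (layer n κ' (k + 3 + 2))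
      rw [layer_add_two hi, layer_add_two hi, show k + 3 + 1 = k + 4 from rfl, hlay3, hlay4, hκ4,
        ← hκ3, List.drop_append_of_le_length hl3.le, List.take_succ_cons, List.map_append,
        List.append_assoc]
      refine List.rel_append (forall₂_relUpTo_refl u _) ?_
      exact List.Forall₂.cons (Or.inr (List.prefix_append _ _)) (forall₂_relUpTo_refl u _)
    · have ih0 := ih 0 (by omega) (by omega)
      refine forall₂_layer (j := k + 4) hi ?_ ih0.1 ih0.2
      rw [hlay4, hκ4, List.drop_succ_cons]
      exact forall₂_relUpTo_refl u _
    · have ih0 := ih i (by omega) (by omega)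
      have ih1 := ih (i + 1) (by omega) (by omega)
      refine forall₂_layer (j := k + i + 5) hi ?_ ih1.1 ih1.2
      rw [← ih0.2]
      exact List.forall₂_drop _ ih0.1
  obtain ⟨i, rfl⟩ := Nat.exists_eq_add_of_le (show k + 5 ≤ j from hj3)
  rw [show k + 5 + i = k + i + 5 by omega]
  exact (key i (by omega)).2

/-- Cliques that differ in one route are at adjacent points of the grid. -/
theorem coord_of_differsBy (hn : 2 ≤ n) {κ κ' : ℕ → ℕ} (hκ : Admissible n κ n)
    (hκ' : Admissible n κ' n) {r r' : List (ZigEdge n)} (h : DiffersBy n κ κ' r)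
    (h' : DiffersBy n κ' κ r') {k : ℕ} (hk : k + 2 < n) (hlow : ∀ j < k + 2, κ j = κ' j)
    (hlt : κ (k + 2) < κ' (k + 2)) {l : ℕ} (hl : l + 2 < n) :
    coord (cliqueFlow (layerClique n κ)) l =
      coord (cliqueFlow (layerClique n κ')) l + if l = k then 1 else 0 := by
  induction l using Nat.strong_induction_on with
  | _ l ih =>
  have h1 := coord_cliqueFlow hn hκ hl
  have h2 := coord_cliqueFlow hn hκ' hl
  have h3 := move_of_differsBy hn hκ hκ' h h' hk hlow hlt hl
  rcases Nat.lt_or_ge l 2 with hl2 | hl2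
  · rw [if_neg (by omega)] at h1 h2
    split_ifs at h3 ⊢ <;> omega
  · have h4 := ih (l - 2) (by omega) (by omega)
    rw [if_pos hl2] at h1 h2
    split_ifs at h3 h4 ⊢ <;> omega

theorem exists_coord_eq_of_differsBy (hn : 2 ≤ n) {κ κ' : ℕ → ℕ} (hκ : Admissible n κ n)
    (hκ' : Admissible n κ' n) {r r' : List (ZigEdge n)} (h : DiffersBy n κ κ' r)
    (h' : DiffersBy n κ' κ r') (hne : layerClique n κ ≠ layerClique n κ') :
    ∃ k, k + 2 < n ∧
      ((∀ l, l + 2 < n → coord (cliqueFlow (layerClique n κ)) l =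
        coord (cliqueFlow (layerClique n κ')) l + if l = k then 1 else 0) ∨
      (∀ l, l + 2 < n → coord (cliqueFlow (layerClique n κ')) l =
        coord (cliqueFlow (layerClique n κ)) l + if l = k then 1 else 0)) := by
  classical
  have hex : ∃ i, i < n ∧ κ i ≠ κ' i := by
    by_contra hcon
    push Not at hcon
    refine hne ?_
    rw [layerClique, layerClique, layer_congr hcon]
  have hspec := Nat.find_spec hex
  have hmin : ∀ j < Nat.find hex, κ j = κ' j := fun j hj => by
    by_contra hc
    exact Nat.find_min hex hj ⟨hj.trans hspec.1, hc⟩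
  generalize Nat.find hex = i at hspec hmin
  rcases i with _ | _ | k
  · exact absurd (hκ.zero.trans hκ'.zero.symm) hspec.2
  · exact absurd (hκ.one.trans hκ'.one.symm) hspec.2
  · refine ⟨k, hspec.1, ?_⟩
    rcases lt_or_gt_of_ne hspec.2 with hlt | hlt
    · exact Or.inl fun l hl => coord_of_differsBy hn hκ hκ' h h' hspec.1 hmin hlt hl
    · exact Or.inr fun l hl => coord_of_differsBy hn hκ' hκ h' h hspec.1
        (fun j hj => (hmin j hj).symm) hlt hl

/-! ### The embedding into the grid -/

/-- The lattice point of a simplex of the triangulation. -/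
noncomputable def gridPoint (Δ : dkkTriangulation n) : Fin (n - 2) → ℤ :=
  fun k => coord (cliqueFlow Δ.2.choose) k

theorem cliqueSimplex_injective (hn : 2 ≤ n) {C C' : Set (Route n)} (hC : IsMaxClique C)
    (hC' : IsMaxClique C') (h : cliqueSimplex C = cliqueSimplex C') : C = C' := by
  obtain ⟨κ, -, rfl⟩ := exists_eq_layerClique hn hC
  obtain ⟨κ', -, rfl⟩ := exists_eq_layerClique hn hC'
  rw [← vertexRoutes_cliqueSimplex hn κ, h, vertexRoutes_cliqueSimplex hn κ']

theorem gridPoint_simplexOf (hn : 2 ≤ n) {C : Set (Route n)} (hC : IsMaxClique C)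
    (k : Fin (n - 2)) : gridPoint (simplexOf C hC) k = coord (cliqueFlow C) k := by
  have hspec := (simplexOf C hC).2.choose_spec
  rw [gridPoint, ← cliqueSimplex_injective hn hC hspec.1 hspec.2]

theorem eq_of_cliqueFlow_eq (hn : 2 ≤ n) {κ κ' : ℕ → ℕ} (hκ : Admissible n κ n)
    (hκ' : Admissible n κ' n)
    (h : cliqueFlow (layerClique n κ) = cliqueFlow (layerClique n κ')) :
    layerClique n κ = layerClique n κ' := by
  rw [layerClique, layerClique, layer_congr]
  rintro (_ | i) hi
  · rw [hκ.zero, hκ'.zero]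
  · have h1 := xval_cliqueFlow hn hκ hi
    rw [h, xval_cliqueFlow hn hκ' hi] at h1
    exact_mod_cast h1.symm

theorem exists_simplexOf (Δ : dkkTriangulation n) :
    ∃ (C : Set (Route n)) (hC : IsMaxClique C), Δ = simplexOf C hC := by
  obtain ⟨Δ, C, hC, rfl⟩ := Δ
  exact ⟨C, hC, rfl⟩

theorem gridPoint_injective (hn : 2 ≤ n) : Function.Injective (gridPoint (n := n)) := by
  intro Δ Δ' h
  obtain ⟨C, hC, rfl⟩ := exists_simplexOf Δ
  obtain ⟨C', hC', rfl⟩ := exists_simplexOf Δ'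
  obtain ⟨κ, hκ, rfl⟩ := exists_eq_layerClique hn hC
  obtain ⟨κ', hκ', rfl⟩ := exists_eq_layerClique hn hC'
  have hflow : cliqueFlow (layerClique n κ) = cliqueFlow (layerClique n κ') := by
    refine ext_of_coord hn (cliqueFlow_mem hn hκ) (cliqueFlow_mem hn hκ') fun k hk => ?_
    have := congrFun h ⟨k, by omega⟩
    rwa [gridPoint_simplexOf hn, gridPoint_simplexOf hn] at this
  simp only [eq_of_cliqueFlow_eq hn hκ hκ' hflow]

theorem differsBy_of_insert {κ κ' : ℕ → ℕ} {K : Set (Route n)} {R R' : Route n}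
    (h : insert R K = layerClique n κ) (h' : insert R' K = layerClique n κ') (hn : 2 ≤ n) :
    DiffersBy n κ κ' R.1 := by
  intro l hl hl'
  let S : Route n := ⟨l, isPath_of_mem_layer hn (by omega) le_rfl hl⟩
  have hS : S ∈ insert R K := h ▸ hl
  rcases Set.mem_insert_iff.1 hS with rfl | hK
  · rfl
  · have : S ∈ layerClique n κ' := h' ▸ Set.mem_insert_of_mem _ hK
    exact absurd this hl'

theorem gridPoint_adj (hn : 2 ≤ n) {Δ Δ' : dkkTriangulation n} (h : (dualGraph n).Adj Δ Δ') :
    (gridGraph (n - 2)).Adj (gridPoint Δ) (gridPoint Δ') := by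
  obtain ⟨hne, F, hF, hF'⟩ := h
  obtain ⟨C, hC, rfl⟩ := exists_simplexOf Δ
  obtain ⟨C', hC', rfl⟩ := exists_simplexOf Δ'
  obtain ⟨κ, hκ, rfl⟩ := exists_eq_layerClique hn hC
  obtain ⟨κ', hκ', rfl⟩ := exists_eq_layerClique hn hC'
  obtain ⟨R, -, hR⟩ := IsFacet.exists_insert hn hF
  obtain ⟨R', -, hR'⟩ := IsFacet.exists_insert hn hF'
  have hne' : layerClique n κ ≠ layerClique n κ' := fun h => hne (by simp only [h])
  obtain ⟨k, hk, hcases⟩ := exists_coord_eq_of_differsBy hn hκ hκ'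
    (differsBy_of_insert hR hR' hn) (differsBy_of_insert hR' hR hn) hne'
  refine ⟨⟨k, by omega⟩, ?_⟩
  rcases hcases with h | h
  · right
    funext l
    rw [Pi.add_apply, gridPoint_simplexOf hn, gridPoint_simplexOf hn, h l (by omega),
      Pi.single_apply]
    simp only [Fin.ext_iff]
  · left
    funext l
    rw [Pi.add_apply, gridPoint_simplexOf hn, gridPoint_simplexOf hn, h l (by omega),
      Pi.single_apply]
    simp only [Fin.ext_iff]

end Zig

theorem theorem1 (n : ℕ) (hn : 2 ≤ n) :
    ∃ f : SimpleGraph.Copy (Zig.dualGraph n) (Zig.gridGraph (n - 2)),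
      ∀ (C : Set (Zig.Route n)) (hC : Zig.IsMaxClique C),
        Zig.cliqueFlow C ∈ Zig.intFlows n ∧
        (∃ s : List (Zig.Move n), Zig.Leads s (Zig.slackFlow n) (Zig.cliqueFlow C)) ∧
        ∀ s : List (Zig.Move n), Zig.Leads s (Zig.slackFlow n) (Zig.cliqueFlow C) →
          f.toHom (Zig.simplexOf C hC) = Zig.signedSum s := by
  refine ⟨⟨⟨Zig.gridPoint, Zig.gridPoint_adj hn⟩, Zig.gridPoint_injective hn⟩, fun C hC => ?_⟩
  obtain ⟨κ, hκ, rfl⟩ := Zig.exists_eq_layerClique hn hC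
  have hmem := Zig.cliqueFlow_mem hn hκ
  refine ⟨hmem, Zig.exists_leads hn hmem, fun s hs => funext fun k => ?_⟩
  have := hs.coord_eq k
  rw [Zig.slackFlow_coord, zero_add] at this
  exact (Zig.gridPoint_simplexOf hn hC k).trans this
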